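/- Let $\mathfrak{sl}_2^c$ be the complex $\mathbb Z_2\times\mathbb Z_2$-graded Lie colour algebra with commutation factor $\varepsilon(\alpha_1\alpha_2,\beta_1\beta_2)=(-1)^{\alpha_1\beta_2-\alpha_2\beta_1}$, with basis $a_1,a_2,a_3$ of degrees $10,01,11$ and bracket $[\![a_1,a_2]\!]=a_3$, $[\![a_2,a_3]\!]=a_1$, $[\![a_3,a_1]\!]=a_2$. An ungraded module is a complex vector space $V$ with a linear map $\rho:\mathfrak{sl}_2^c\to\mathrm{End}(V)$ such that $\rho([\![x,y]\!])=\rho(x)\rho(y)-\varepsilon(\alpha,\beta)\rho(y)\rho(x)$ for $x,y$ of degrees $\alpha,\beta$; it is irreducible if it is nonzero and has no submodules (graded or not) other than $0$ and itself. For an integer $\lambda\ge 0$ let $V_\lambda$ have basis $v_0,\dots,v_\lambda$, with $v_{-1}=v_{\lambda+1}=0$, $hv_j=(\lambda-2j)v_j$, $ev_j=(\lambda-j+1)v_{j-1}$, $fv_j=(j+1)v_{j+1}$, and let $a_1,a_2,a_3$ act on it as $\frac i2(e-f)$, $-\frac12(e+f)$, $-\frac i2h$. For a $\mathbb Z_2\times\mathbb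 Z_2$-graded space $V$ with such operators, of degrees $10,01,11$, the recoloured action $V^\sigma$ is $x\cdot v=\sigma(\alpha,\gamma)\,xv$ for $x$ of degree $\alpha$ and $v\in V_\gamma$, where $\sigma(\alpha_1\alpha_2,\beta_1\beta_2)=(-1)^{\alpha_2\beta_1}$. For $\lambda$ even, $V_\lambda^{E+}$ is $V_\lambda$ graded by letting the sectors $00,10,01,11$ be spanned by the vectors $v_j+v_{\lambda-j}$ ($j$ even), $v_j-v_{\lambda-j}$ ($j$ odd), $v_j+v_{\lambda-j}$ ($j$ odd), $v_j-v_{\lambda-j}$ ($j$ even) respectively. For $\lambda$ odd, let $L_\lambda\subset V_\lambda\otimes\mathbb C[\mathbb Z_2\times\mathbb Z_2]$ be the loop module of $V_\lambda$ by $H=\{00,11\}$, where $V_\lambda$ is graded by $(\mathbb Z_2\times\mathbb Z_2)/H$ with $v_j$ in the class of $00$ for $j$ even and in the class of $01$ for $j$ odd. That is, $L_\lambda=\bigoplus_\gamma (V_\lambda)_{\gamma+H}\otimes e_\gamma$, with $x(v\otimes e_\beta)=xv\otimes e_{\alpha+\beta}$ for $x$ of degree $\alpha$. It has the basis $v_{0,j}=v_j\otimes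 e_{00}$, $v_{1,j}=v_j\otimes e_{11}$ for $j$ even and $v_{0,j}=v_j\otimes e_{01}$, $v_{1,j}=v_j\otimes e_{10}$ for $j$ odd. For $\zeta,\xi\in\{-1,+1\}$ let $U_\lambda^{\zeta\xi}\subset (L_\lambda)^\sigma$ be the span of $$u^{\zeta\xi}_j=v_{0,j}+\zeta i(-1)^jv_{1,j}+\xi v_{0,\lambda-j}-\zeta\xi i(-1)^jv_{1,\lambda-j},\qquad 0\le j\le\tfrac{\lambda-1}2 .$$ Theorem. Up to isomorphism, the finite-dimensional ungraded irreducible modules of $\mathfrak{sl}_2^c$ are exactly the following modules, which are pairwise non-isomorphic. (i) For each even $\lambda\ge 0$, the module $(V_\lambda^{E+})^\sigma$, of dimension $\lambda+1$. The vectors $u_j=(v_j+v_{\lambda-j})+i(-1)^j(v_j-v_{\lambda-j})$, $0\le j\le\lambda$, form a basis, and with $u_{-1}=u_{\lambda+1}=0$ the action is $$a_1u_j=\tfrac{(-1)^{j+1}}2\big((\lambda-j+1)u_{j-1}-(j+1)u_{j+1}\big),\quad a_2u_j=-\tfrac12\big((\lambda-j+1)u_{j-1}+(j+1)u_{j+1}\big),\quad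 a_3u_j=\tfrac{(-1)^{j+1}}2(\lambda-2j)u_j.$$ (ii) For each odd $\lambda\ge 1$ and all $\zeta,\xi\in\{-1,+1\}$, the module $U_\lambda^{\zeta\xi}$, a submodule of $(L_\lambda)^\sigma$ of dimension $(\lambda+1)/2$. The vectors $u_j=u_j^{\zeta\xi}$, $0\le j\le(\lambda-1)/2$, form a basis, and with $u_{-1}=0$ the action is, for $j<(\lambda-1)/2$, $$a_1u_j=-\tfrac\zeta2(-1)^j\big((\lambda-j+1)u_{j-1}-(j+1)u_{j+1}\big),\quad a_2u_j=-\tfrac12\big((\lambda-j+1)u_{j-1}+(j+1)u_{j+1}\big),$$ for $m=(\lambda-1)/2$, $$a_1u_m=-\tfrac\zeta2(-1)^m\big(\tfrac{\lambda+3}2u_{m-1}-\xi\tfrac{\lambda+1}2u_m\big),\quad a_2u_m=-\tfrac12\big(\tfrac{\lambda+3}2u_{m-1}+\xi\tfrac{\lambda+1}2u_m\big),$$ and $a_3u_j=-\tfrac\zeta2(-1)^j(\lambda-2j)u_j$ for all $0\le j\le(\lambda-1)/2$. -/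

import Mathlib

noncomputable section

namespace ColourSl2

/-! ## Gradings -/

/-- A grading of a vector space `V` by an abelian group `Γ`: a direct sum decomposition
`V = ⨁ γ, V_γ` into sectors. -/
structure Grading (𝕜 Γ V : Type*) [Field 𝕜] [AddCommGroup V] [Module 𝕜 V] where
  sector : Γ → Submodule 𝕜 V
  isInternal : letI := Classical.decEq Γ; DirectSum.IsInternal sector

section Grading

variable {𝕜 Γ V : Type*} [Field 𝕜] [AddCommGroup V] [Module 𝕜 V]

theorem Grading.bijective (W : Grading 𝕜 Γ V) :
    let := Classical.decEq Γ
    Function.Bijective (DirectSum.coeLinearMap W.sector) := W.isInternal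

/-- The projection of a graded space onto its `γ`-sector. -/
def Grading.proj (W : Grading 𝕜 Γ V) (γ : Γ) : V →ₗ[𝕜] V :=
  letI := Classical.decEq Γ
  (W.sector γ).subtype ∘ₗ DirectSum.component 𝕜 Γ (fun δ => W.sector δ) γ ∘ₗ
    (LinearEquiv.ofBijective (DirectSum.coeLinearMap W.sector) W.bijective).symm.toLinearMap

theorem Grading.proj_mem (W : Grading 𝕜 Γ V) (γ : Γ) (v : V) : W.proj γ v ∈ W.sector γ := by
  simp [Grading.proj]

theorem Grading.proj_of_mem (W : Grading 𝕜 Γ V) {γ : Γ} {v : V} (hv : v ∈ W.sector γ) :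
    W.proj γ v = v := by
  let := Classical.decEq Γ
  have h : (LinearEquiv.ofBijective (DirectSum.coeLinearMap W.sector) W.bijective).symm v =
      DirectSum.lof 𝕜 Γ (fun δ => W.sector δ) γ ⟨v, hv⟩ := by
    rw [LinearEquiv.symm_apply_eq, LinearEquiv.ofBijective_apply]
    exact (DirectSum.coeLinearMap_lof W.sector γ ⟨v, hv⟩).symm
  simp only [Grading.proj, LinearMap.comp_apply, LinearEquiv.coe_coe]
  rw [h]
  simp [DirectSum.component.lof_self]

theorem Grading.proj_of_mem_ne (W : Grading 𝕜 Γ V) {γ δ : Γ} (hne : γ ≠ δ) {v : V}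
    (hv : v ∈ W.sector γ) : W.proj δ v = 0 := by
  let := Classical.decEq Γ
  have h : (LinearEquiv.ofBijective (DirectSum.coeLinearMap W.sector) W.bijective).symm v =
      DirectSum.lof 𝕜 Γ (fun δ => W.sector δ) γ ⟨v, hv⟩ := by
    rw [LinearEquiv.symm_apply_eq, LinearEquiv.ofBijective_apply]
    exact (DirectSum.coeLinearMap_lof W.sector γ ⟨v, hv⟩).symm
  simp only [Grading.proj, LinearMap.comp_apply, LinearEquiv.coe_coe]
  rw [h]
  simp [DirectSum.component.of, hne]

theorem isInternal_of_proj (A : Γ → Submodule 𝕜 V) (p : Γ → V →ₗ[𝕜] V)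
    (hself : ∀ γ, ∀ v ∈ A γ, p γ v = v) (hne : ∀ γ δ, γ ≠ δ → ∀ v ∈ A γ, p δ v = 0)
    (htop : ⨆ γ, A γ = ⊤) :
    letI := Classical.decEq Γ; DirectSum.IsInternal A := by
  let := Classical.decEq Γ
  refine DirectSum.isInternal_submodule_of_iSupIndep_of_iSup_eq_top ?_ htop
  intro γ
  rw [Submodule.disjoint_def]
  intro v hv hv'
  have hle : ⨆ (δ) (_ : δ ≠ γ), A δ ≤ LinearMap.ker (p γ) :=
    iSup₂_le fun δ hδ w hw => hne δ γ hδ w hw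
  rw [← hself γ v hv]
  exact hle hv'

/-- The grading for which the vectors of a given basis are homogeneous of given degrees. -/
def Grading.ofBasis {ι : Type*} (b : Module.Basis ι 𝕜 V) (deg : ι → Γ) : Grading 𝕜 Γ V where
  sector γ := Submodule.span 𝕜 {v | ∃ i, deg i = γ ∧ v = b i}
  isInternal := by
    let := Classical.decEq Γ
    refine isInternal_of_proj _
      (fun γ => b.constr 𝕜 fun i => if deg i = γ then b i else 0) ?_ ?_ ?_
    · intro γ v hv
      induction hv using Submodule.span_induction with
      | mem x hx => obtain ⟨i, hi, rfl⟩ := hx; simp [Module.Basis.constr_basis, hi]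
      | zero => simp
      | add x y _ _ hx hy => rw [map_add, hx, hy]
      | smul c x _ hx => rw [map_smul, hx]
    · intro γ δ hne v hv
      induction hv using Submodule.span_induction with
      | mem x hx => obtain ⟨i, hi, rfl⟩ := hx; simp [Module.Basis.constr_basis, hi, hne]
      | zero => simp
      | add x y _ _ hx hy => rw [map_add, hx, hy, add_zero]
      | smul c x _ hx => rw [map_smul, hx, smul_zero]
    · rw [eq_top_iff, ← b.span_eq, Submodule.span_le]
      rintro _ ⟨i, rfl⟩
      exact Submodule.mem_iSup_of_mem (deg i) (Submodule.subset_span ⟨i, rfl, rfl⟩)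

end Grading

/-! ## Lie colour algebras and their representations -/

/-- A commutation factor on an abelian group `Γ`. -/
structure IsCommutationFactor {𝕜 Γ : Type*} [Field 𝕜] [AddCommGroup Γ] (ε : Γ → Γ → 𝕜) :
    Prop where
  mul_symm : ∀ α β, ε α β * ε β α = 1
  add_left : ∀ α β γ, ε (α + β) γ = ε α γ * ε β γ
  add_right : ∀ α β γ, ε α (β + γ) = ε α β * ε α γ

/-- A Lie colour algebra structure on the vector space `L`, with grading group `Γ` and
commutation factor `ε`. -/
structure LieColourAlgebra (𝕜 : Type*) {Γ : Type*} (L : Type*) [Field 𝕜] [AddCommGroup Γ]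
    [AddCommGroup L] [Module 𝕜 L] (ε : Γ → Γ → 𝕜) where
  isCommutationFactor : IsCommutationFactor ε
  grading : Grading 𝕜 Γ L
  bracket : L →ₗ[𝕜] L →ₗ[𝕜] L
  bracket_mem : ∀ α β, ∀ x ∈ grading.sector α, ∀ y ∈ grading.sector β,
    bracket x y ∈ grading.sector (α + β)
  skew : ∀ α β, ∀ x ∈ grading.sector α, ∀ y ∈ grading.sector β,
    bracket x y = -(ε α β • bracket y x)
  jacobi : ∀ α β γ, ∀ x ∈ grading.sector α, ∀ y ∈ grading.sector β, ∀ z ∈ grading.sector γ,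
    ε γ α • bracket x (bracket y z) + ε α β • bracket y (bracket z x) +
      ε β γ • bracket z (bracket x y) = 0

section Representations

variable {𝕜 Γ L V : Type*} [Field 𝕜] [AddCommGroup Γ] [AddCommGroup L] [Module 𝕜 L]
  [AddCommGroup V] [Module 𝕜 V]

/-- `ρ` is an ungraded representation of the Lie colour algebra `𝔤` on `V`. -/
def IsUngradedRep {ε : Γ → Γ → 𝕜} (𝔤 : LieColourAlgebra 𝕜 L ε)
    (ρ : L →ₗ[𝕜] Module.End 𝕜 V) : Prop :=
  ∀ α β, ∀ x ∈ 𝔤.grading.sector α, ∀ y ∈ 𝔤.grading.sector β,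
    ρ (𝔤.bracket x y) = ρ x * ρ y - ε α β • (ρ y * ρ x)

/-- The subspace `U` is stable under the operators `ρ x`, i.e. an (ungraded) submodule. -/
def IsStable {𝕜 L V : Type*} [Field 𝕜] [AddCommGroup L] [Module 𝕜 L] [AddCommMonoid V]
    [Module 𝕜 V] (ρ : L →ₗ[𝕜] Module.End 𝕜 V) (U : Submodule 𝕜 V) : Prop :=
  ∀ x, ∀ v ∈ U, ρ x v ∈ U

/-- The action on a submodule. -/
def subrep (ρ : L →ₗ[𝕜] Module.End 𝕜 V) (U : Submodule 𝕜 V) (hU : IsStable ρ U) :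
    L →ₗ[𝕜] Module.End 𝕜 U where
  toFun x := (ρ x).restrict (hU x)
  map_add' x y := by ext v; simp
  map_smul' c x := by ext v; simp

/-- Ungraded irreducibility: `V` is nonzero, with no submodules but `0` and `V`. -/
def IsIrreducibleRep {𝕜 L V : Type*} [Field 𝕜] [AddCommGroup L] [Module 𝕜 L] [AddCommMonoid V]
    [Module 𝕜 V] (ρ : L →ₗ[𝕜] Module.End 𝕜 V) : Prop :=
  Nontrivial V ∧ ∀ U : Submodule 𝕜 V, IsStable ρ U → U = ⊥ ∨ U = ⊤

/-- Isomorphism of ungraded modules: a bijective linear intertwiner (of any kind with respect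
to gradings). -/
def Isomorphic {𝕜 L V V' : Type*} [Field 𝕜] [AddCommGroup L] [Module 𝕜 L]
    [AddCommMonoid V] [Module 𝕜 V] [AddCommMonoid V'] [Module 𝕜 V']
    (ρ : L →ₗ[𝕜] Module.End 𝕜 V) (ρ' : L →ₗ[𝕜] Module.End 𝕜 V') : Prop :=
  ∃ φ : V ≃ₗ[𝕜] V', ∀ x v, φ (ρ x v) = ρ' x (φ v)

/-- The deformation of the action on a `Γ`-graded module by a multiplier `σ` (discolouration or
recolouring): `ρ^σ(x) v = σ(α, γ) ρ(x) v` for `x ∈ L_α`, `v ∈ V_γ`. -/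
def recolour [Fintype Γ] (σ : Γ → Γ → 𝕜) (G : Grading 𝕜 Γ L) (W : Grading 𝕜 Γ V)
    (ρ : L →ₗ[𝕜] Module.End 𝕜 V) : L →ₗ[𝕜] Module.End 𝕜 V :=
  ∑ α, ∑ γ, σ α γ • (LinearMap.lcomp 𝕜 V (W.proj γ) ∘ₗ ρ ∘ₗ G.proj α)

theorem recolour_apply_of_mem {𝕜 Γ L V : Type*} [Field 𝕜] [AddCommGroup L] [Module 𝕜 L]
    [AddCommGroup V] [Module 𝕜 V] [Fintype Γ] (σ : Γ → Γ → 𝕜) (G : Grading 𝕜 Γ L)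
    (W : Grading 𝕜 Γ V) (ρ : L →ₗ[𝕜] Module.End 𝕜 V) {α γ : Γ} {x : L} {v : V}
    (hx : x ∈ G.sector α) (hv : v ∈ W.sector γ) :
    recolour σ G W ρ x v = σ α γ • ρ x v := by
  simp only [recolour, LinearMap.sum_apply, LinearMap.smul_apply, LinearMap.comp_apply,
    LinearMap.lcomp_apply]
  rw [Finset.sum_eq_single α, Finset.sum_eq_single γ, G.proj_of_mem hx, W.proj_of_mem hv]
  · intro δ _ hδ
    rw [W.proj_of_mem_ne (Ne.symm hδ) hv, map_zero, smul_zero]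
  · simp
  · intro δ _ hδ
    rw [G.proj_of_mem_ne (Ne.symm hδ) hx]
    simp
  · simp

/-- The action `ρ` is compatible with a `Γ ⧸ H`-grading `W` of `V` (and the `Γ ⧸ H`-grading of
`L` that comes from its `Γ`-grading `G`). -/
def IsGradedAction (G : Grading 𝕜 Γ L) (H : AddSubgroup Γ) (W : Grading 𝕜 (Γ ⧸ H) V)
    (ρ : L →ₗ[𝕜] Module.End 𝕜 V) : Prop :=
  ∀ (α : Γ) (Λ : Γ ⧸ H), ∀ x ∈ G.sector α, ∀ v ∈ W.sector Λ, ρ x v ∈ W.sector ((α : Γ ⧸ H) + Λ)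

/-- The action on `V ⊗ 𝕜Γ` given by `x (v ⊗ e_β) = x v ⊗ e_{α + β}` for `x ∈ L_α`. Here
`V ⊗ 𝕜Γ` is realised as `Γ →₀ V`, with `v ⊗ e_γ = Finsupp.single γ v`. -/
def tensorAction [Fintype Γ] (G : Grading 𝕜 Γ L) (ρ : L →ₗ[𝕜] Module.End 𝕜 V) :
    L →ₗ[𝕜] Module.End 𝕜 (Γ →₀ V) where
  toFun x := ∑ α, Finsupp.lsum 𝕜 fun β : Γ =>
    (Finsupp.lsingle (α + β) : V →ₗ[𝕜] (Γ →₀ V)) ∘ₗ ρ (G.proj α x)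
  map_add' x y := by
    rw [← Finset.sum_add_distrib]
    refine Finset.sum_congr rfl fun α _ => ?_
    ext β v : 2
    simp
  map_smul' c x := by
    rw [Finset.smul_sum]
    refine Finset.sum_congr rfl fun α _ => ?_
    ext β v : 2
    simp

theorem tensorAction_single_of_mem [Fintype Γ] (G : Grading 𝕜 Γ L)
    (ρ : L →ₗ[𝕜] Module.End 𝕜 V) {α : Γ} {x : L} (hx : x ∈ G.sector α) (β : Γ) (v : V) :
    tensorAction G ρ x (Finsupp.single β v) = Finsupp.single (α + β) (ρ x v) := by
  simp only [tensorAction, LinearMap.coe_mk, AddHom.coe_mk, LinearMap.sum_apply]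
  rw [Finset.sum_eq_single α]
  · simp [G.proj_of_mem hx]
  · intro δ _ hδ
    simp [G.proj_of_mem_ne (Ne.symm hδ) hx]
  · simp

/-- The subspace `⨁ γ, V_{γ + H} ⊗ e_γ` of `V ⊗ 𝕜Γ` underlying the loop module. -/
def loopSpace (H : AddSubgroup Γ) (W : Grading 𝕜 (Γ ⧸ H) V) : Submodule 𝕜 (Γ →₀ V) where
  carrier := {w | ∀ γ : Γ, w γ ∈ W.sector (γ : Γ ⧸ H)}
  add_mem' hv hw γ := Submodule.add_mem _ (hv γ) (hw γ)
  zero_mem' _ := Submodule.zero_mem _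
  smul_mem' c _ hw γ := Submodule.smul_mem _ c (hw γ)

theorem single_mem_loopSpace {H : AddSubgroup Γ} {W : Grading 𝕜 (Γ ⧸ H) V} {γ : Γ} {v : V}
    (hv : v ∈ W.sector (γ : Γ ⧸ H)) : Finsupp.single γ v ∈ loopSpace H W := by
  classical
  intro δ
  rw [Finsupp.single_apply]
  split_ifs with h
  · exact h ▸ hv
  · exact Submodule.zero_mem _

theorem isStable_loopSpace [Fintype Γ] {G : Grading 𝕜 Γ L} {H : AddSubgroup Γ}
    {W : Grading 𝕜 (Γ ⧸ H) V} {ρ : L →ₗ[𝕜] Module.End 𝕜 V} (h : IsGradedAction G H W ρ) :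
    IsStable (tensorAction G ρ) (loopSpace H W) := by
  classical
  intro x w hw
  rw [← Finsupp.sum_single w, Finsupp.sum, map_sum]
  refine Submodule.sum_mem _ fun β _ => ?_
  simp only [tensorAction, LinearMap.coe_mk, AddHom.coe_mk, LinearMap.sum_apply]
  refine Submodule.sum_mem _ fun α _ => ?_
  simp only [Finsupp.lsum_single, LinearMap.comp_apply, Finsupp.lsingle_apply]
  exact single_mem_loopSpace (h α β _ (G.proj_mem α x) _ (hw β))

/-- The loop module of the `Γ ⧸ H`-graded module `V` by `H`. -/
def loopRep [Fintype Γ] {G : Grading 𝕜 Γ L} {H : AddSubgroup Γ} {W : Grading 𝕜 (Γ ⧸ H) V}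
    {ρ : L →ₗ[𝕜] Module.End 𝕜 V} (h : IsGradedAction G H W ρ) :
    L →ₗ[𝕜] Module.End 𝕜 (loopSpace H W) :=
  subrep (tensorAction G ρ) (loopSpace H W) (isStable_loopSpace h)

/-- The `Γ`-grading of the loop module; its `γ`-sector is `V_{γ + H} ⊗ e_γ`. -/
def loopGrading (H : AddSubgroup Γ) (W : Grading 𝕜 (Γ ⧸ H) V) :
    Grading 𝕜 Γ (loopSpace H W) where
  sector γ :=
    { carrier := {w | ∀ δ : Γ, δ ≠ γ → (w : Γ →₀ V) δ = 0}
      add_mem' := fun hv hw δ hδ => by simp [hv δ hδ, hw δ hδ]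
      zero_mem' := fun _ _ => rfl
      smul_mem' := fun c w hw δ hδ => by simp [hw δ hδ] }
  isInternal := by
    classical
    refine isInternal_of_proj _ (fun γ =>
      { toFun := fun w => ⟨Finsupp.single γ ((w : Γ →₀ V) γ), single_mem_loopSpace (w.2 γ)⟩
        map_add' := fun v w => by ext1; simp
        map_smul' := fun c w => by ext1; simp }) ?_ ?_ ?_
    · intro γ w hw
      ext δ
      by_cases h : δ = γ
      · subst h; simp
      · simp only [LinearMap.coe_mk, AddHom.coe_mk]
        rw [Finsupp.single_eq_of_ne h, hw δ h]
    · intro γ δ hne w hw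
      ext1
      simp only [LinearMap.coe_mk, AddHom.coe_mk]
      rw [hw δ hne.symm, Finsupp.single_zero]
      rfl
    · rw [eq_top_iff]
      rintro w -
      have hw : w = ∑ γ ∈ (w : Γ →₀ V).support,
          (⟨Finsupp.single γ ((w : Γ →₀ V) γ), single_mem_loopSpace (w.2 γ)⟩ :
            loopSpace H W) := by
        ext1
        rw [AddSubmonoidClass.coe_finsetSum]
        exact (Finsupp.sum_single (w : Γ →₀ V)).symm
      rw [hw]
      refine Submodule.sum_mem _ fun γ _ => Submodule.mem_iSup_of_mem γ ?_
      intro δ hδ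
      exact Finsupp.single_eq_of_ne hδ

end Representations

/-! ## Colour `sl₂` -/

/-- The grading group `ℤ₂ × ℤ₂`. -/
abbrev Gam : Type := ZMod 2 × ZMod 2

/-- The commutation factor `ε(α, β) = (-1)^(α₁β₂ - α₂β₁)`. -/
def epsFactor (α β : Gam) : ℂ := (-1) ^ (α.1 * β.2 - α.2 * β.1).val

/-- The multiplier `σ(α, β) = (-1)^(α₂β₁)`. -/
def sigMult (α β : Gam) : ℂ := (-1) ^ (α.2 * β.1).val

/-- The vector space underlying colour `sl₂`, with basis `a₁, a₂, a₃`. -/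
abbrev Slc2 : Type := Fin 3 → ℂ

/-- The basis `a₁, a₂, a₃` (indexed by `0, 1, 2`). -/
def aBasis : Module.Basis (Fin 3) ℂ Slc2 := Pi.basisFun ℂ (Fin 3)

def a₁ : Slc2 := aBasis 0

def a₂ : Slc2 := aBasis 1

def a₃ : Slc2 := aBasis 2

/-- The degrees `10, 01, 11` of `a₁, a₂, a₃`. -/
def aDeg : Fin 3 → Gam := ![(1, 0), (0, 1), (1, 1)]

/-- The `ℤ₂ × ℤ₂`-grading of colour `sl₂`; its `00`-sector is `0`. -/
def slc2Grading : Grading ℂ Gam Slc2 := Grading.ofBasis aBasis aDeg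

/-- The bracket of colour `sl₂`. It is symmetric, because `ε(α, β) = -1` for distinct nonzero
degrees, and `⟦aᵢ, aᵢ⟧ = 0`. -/
def slc2Bracket : Slc2 →ₗ[ℂ] Slc2 →ₗ[ℂ] Slc2 :=
  LinearMap.mk₂ ℂ
    (fun x y => ![x 1 * y 2 + x 2 * y 1, x 2 * y 0 + x 0 * y 2, x 0 * y 1 + x 1 * y 0])
    (by intro x x' y; ext i; fin_cases i <;> simp <;> ring)
    (by intro c x y; ext i; fin_cases i <;> simp <;> ring)
    (by intro x y y'; ext i; fin_cases i <;> simp <;> ring)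
    (by intro c x y; ext i; fin_cases i <;> simp <;> ring)

theorem slc2Bracket_values :
    slc2Bracket a₁ a₂ = a₃ ∧ slc2Bracket a₂ a₃ = a₁ ∧ slc2Bracket a₃ a₁ = a₂ := by
  refine ⟨?_, ?_, ?_⟩ <;> ext i <;> fin_cases i <;>
    simp [slc2Bracket, a₁, a₂, a₃, aBasis]

theorem neg_one_pow_val_add (x y : ZMod 2) :
    (-1 : ℂ) ^ (x + y).val = (-1) ^ x.val * (-1) ^ y.val := by
  have h : (x + y).val % 2 = (x.val + y.val) % 2 := by revert x y; decide
  rw [← pow_add, neg_one_pow_eq_pow_mod_two, h, ← neg_one_pow_eq_pow_mod_two]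

theorem epsFactor_isCommutationFactor : IsCommutationFactor epsFactor where
  mul_symm α β := by
    rw [epsFactor, epsFactor, ← neg_one_pow_val_add]
    have h : α.1 * β.2 - α.2 * β.1 + (β.1 * α.2 - β.2 * α.1) = 0 := by ring
    rw [h]; simp
  add_left α β γ := by
    rw [epsFactor, epsFactor, epsFactor, ← neg_one_pow_val_add]
    congr 2
    simp only [Prod.fst_add, Prod.snd_add]; ring
  add_right α β γ := by
    rw [epsFactor, epsFactor, epsFactor, ← neg_one_pow_val_add]
    congr 2
    simp only [Prod.fst_add, Prod.snd_add]; ring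

theorem apply_eq_zero_of_mem_sector {α : Gam} {x : Slc2} (hx : x ∈ slc2Grading.sector α)
    {i : Fin 3} (hi : aDeg i ≠ α) : x i = 0 := by
  have hle : slc2Grading.sector α ≤ LinearMap.ker (LinearMap.proj i : Slc2 →ₗ[ℂ] ℂ) := by
    refine Submodule.span_le.2 ?_
    rintro _ ⟨k, hk, rfl⟩
    have : i ≠ k := by rintro rfl; exact hi hk
    simp [aBasis, this]
  exact hle hx

theorem exists_of_mem_sector {α : Gam} {x : Slc2} (hx : x ∈ slc2Grading.sector α) :
    x = 0 ∨ ∃ i, aDeg i = α ∧ ∃ c : ℂ, x = c • aBasis i := by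
  by_cases h : ∃ i, aDeg i = α
  · obtain ⟨i, hi⟩ := h
    refine Or.inr ⟨i, hi, x i, ?_⟩
    have hinj : ∀ k, k ≠ i → aDeg k ≠ aDeg i := by
      clear hi; revert i; unfold aDeg; decide
    ext k
    by_cases hk : k = i
    · subst hk; simp [aBasis]
    · rw [apply_eq_zero_of_mem_sector hx (hi ▸ hinj k hk)]
      simp [aBasis, hk]
  · push Not at h
    exact Or.inl (funext fun i => apply_eq_zero_of_mem_sector hx (h i))

/-- The Lie colour algebra `sl₂ᶜ`. -/
def slc2 : LieColourAlgebra ℂ Slc2 epsFactor where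
  isCommutationFactor := epsFactor_isCommutationFactor
  grading := slc2Grading
  bracket := slc2Bracket
  bracket_mem α β x hx y hy := by
    obtain rfl | ⟨i, rfl, c, rfl⟩ := exists_of_mem_sector hx
    · simp
    obtain rfl | ⟨j, rfl, d, rfl⟩ := exists_of_mem_sector hy
    · simp
    rw [map_smul, map_smul, LinearMap.smul_apply]
    refine Submodule.smul_mem _ _ (Submodule.smul_mem _ _ ?_)
    by_cases hij : i = j
    · subst hij
      have : slc2Bracket (aBasis i) (aBasis i) = 0 := by
        ext k; fin_cases i <;> fin_cases k <;> simp [slc2Bracket, aBasis]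
      rw [this]; exact Submodule.zero_mem _
    · have key : ∃ k, aDeg k = aDeg i + aDeg j ∧ k ≠ i ∧ k ≠ j := by
        clear hx hy; revert i j; unfold aDeg; decide
      obtain ⟨k, hk, hki, hkj⟩ := key
      refine Submodule.subset_span ⟨k, hk, ?_⟩
      ext m
      fin_cases i <;> fin_cases j <;> fin_cases k <;> simp_all <;>
        fin_cases m <;> simp [slc2Bracket, aBasis]
  skew α β x hx y hy := by
    obtain rfl | ⟨i, rfl, c, rfl⟩ := exists_of_mem_sector hx
    · simp
    obtain rfl | ⟨j, rfl, d, rfl⟩ := exists_of_mem_sector hy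
    · simp
    ext m
    fin_cases i <;> fin_cases j <;> fin_cases m <;>
      simp [slc2Bracket, aBasis, epsFactor, aDeg, ZMod.val_one, mul_comm]
  jacobi α β γ x hx y hy z hz := by
    obtain rfl | ⟨i, rfl, c, rfl⟩ := exists_of_mem_sector hx
    · simp
    obtain rfl | ⟨j, rfl, d, rfl⟩ := exists_of_mem_sector hy
    · simp
    obtain rfl | ⟨k, rfl, e, rfl⟩ := exists_of_mem_sector hz
    · simp
    have key : epsFactor (aDeg k) (aDeg i) •
          slc2Bracket (aBasis i) (slc2Bracket (aBasis j) (aBasis k)) +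
        epsFactor (aDeg i) (aDeg j) •
          slc2Bracket (aBasis j) (slc2Bracket (aBasis k) (aBasis i)) +
        epsFactor (aDeg j) (aDeg k) •
          slc2Bracket (aBasis k) (slc2Bracket (aBasis i) (aBasis j)) = 0 := by
      clear hx hy hz
      fin_cases i <;> fin_cases j <;> fin_cases k <;>
        simp [slc2Bracket, aBasis, epsFactor, aDeg, ZMod.val_one]
    simp only [map_smul, LinearMap.smul_apply]
    have h := congrArg (fun t : Slc2 => (c * d * e) • t) key
    simp only [smul_zero] at h
    rw [← h]
    module

/-! ## The `sl₂`-modules `V_l` and their gradings -/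

/-- The vector space underlying the irreducible `sl₂`-module of highest weight `l`. -/
abbrev VSp (l : ℕ) : Type := Fin (l + 1) → ℂ

/-- The basis vector `v_k`, with the convention that `v_k = 0` unless `0 ≤ k ≤ l`. -/
def vVec (l : ℕ) (k : ℤ) : VSp l := fun i => if ((i : ℕ) : ℤ) = k then 1 else 0

theorem vVec_coe (l : ℕ) (j : Fin (l + 1)) : vVec l ((j : ℕ) : ℤ) = Pi.basisFun ℂ (Fin (l + 1)) j := by
  ext i
  simp [vVec, Pi.single_apply, Fin.ext_iff]

theorem vVec_of_not_mem {l : ℕ} {k : ℤ} (h : ¬ (0 ≤ k ∧ k ≤ l)) : vVec l k = 0 := by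
  ext i
  have := i.2
  have : ((i : ℕ) : ℤ) ≠ k := by omega
  simp [vVec, this]

/-- `h v_j = (l - 2j) v_j`. -/
def hOp (l : ℕ) : Module.End ℂ (VSp l) :=
  (Pi.basisFun ℂ (Fin (l + 1))).constr ℂ fun j =>
    ((l : ℂ) - 2 * ((j : ℕ) : ℂ)) • vVec l ((j : ℕ) : ℤ)

/-- `e v_j = (l - j + 1) v_{j-1}`. -/
def eOp (l : ℕ) : Module.End ℂ (VSp l) :=
  (Pi.basisFun ℂ (Fin (l + 1))).constr ℂ fun j =>
    ((l : ℂ) - ((j : ℕ) : ℂ) + 1) • vVec l (((j : ℕ) : ℤ) - 1)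

/-- `f v_j = (j + 1) v_{j+1}`. -/
def fOp (l : ℕ) : Module.End ℂ (VSp l) :=
  (Pi.basisFun ℂ (Fin (l + 1))).constr ℂ fun j =>
    (((j : ℕ) : ℂ) + 1) • vVec l (((j : ℕ) : ℤ) + 1)

/-- The action of the discolouration of `sl₂ᶜ` on `V_l`, through
`a₁ = (i/2)(e - f)`, `a₂ = -(1/2)(e + f)`, `a₃ = -(i/2)h`. -/
def slRep (l : ℕ) : Slc2 →ₗ[ℂ] Module.End ℂ (VSp l) :=
  aBasis.constr ℂ ![(Complex.I / 2) • (eOp l - fOp l), (-(1 / 2) : ℂ) • (eOp l + fOp l),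
    (-(Complex.I / 2)) • hOp l]

/-- For `l` even, the `ℤ₂ × ℤ₂`-grading of `V_l` giving the graded module `V_l^{E+}`:
the sectors `00, 01` are spanned by the `v_j + v_{l-j}`, and the sectors `10, 11` by the
`v_j - v_{l-j}`, with `j` even for `00, 11` and `j` odd for `10, 01`. -/
def gradingEPlus (l : ℕ) (hl : Even l) : Grading ℂ Gam (VSp l) where
  sector γ := Submodule.span ℂ {w | ∃ j : Fin (l + 1), (((j : ℕ) : ℕ) : ZMod 2) = γ.1 + γ.2 ∧
    w = vVec l ((j : ℕ) : ℤ) + ((-1 : ℂ) ^ γ.1.val) • vVec l ((l : ℤ) - ((j : ℕ) : ℤ))}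
  isInternal := by
    classical
    have hl2 : ((l : ℕ) : ZMod 2) = 0 := (ZMod.natCast_eq_zero_iff_even).2 hl
    have hrev : ∀ j : Fin (l + 1), vVec l ((l : ℤ) - ((j : ℕ) : ℤ)) =
        Pi.basisFun ℂ (Fin (l + 1)) j.rev := by
      intro j
      rw [← vVec_coe]
      congr 1
      have := j.2
      rw [Fin.val_rev]
      omega
    have hpar : ∀ j : Fin (l + 1), (((j.rev : Fin (l + 1)) : ℕ) : ZMod 2) = ((j : ℕ) : ZMod 2) := by
      intro j
      have h1 : ((j.rev : Fin (l + 1)) : ℕ) + (j : ℕ) = l := by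
        have := j.2
        rw [Fin.val_rev]
        omega
      have h2 : (((j.rev : Fin (l + 1)) : ℕ) : ZMod 2) + ((j : ℕ) : ZMod 2) = 0 := by
        rw [← Nat.cast_add, h1, hl2]
      generalize (((j.rev : Fin (l + 1)) : ℕ) : ZMod 2) = x at h2 ⊢
      generalize ((j : ℕ) : ZMod 2) = y at h2 ⊢
      revert x y; decide
    have hsq : ∀ x : ZMod 2, ((-1 : ℂ) ^ x.val) * ((-1 : ℂ) ^ x.val) = 1 := by
      intro x; rw [← mul_pow]; simp
    set b := Pi.basisFun ℂ (Fin (l + 1)) with hb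
    let p : Gam → VSp l →ₗ[ℂ] VSp l := fun γ => b.constr ℂ fun j =>
      if (((j : ℕ) : ℕ) : ZMod 2) = γ.1 + γ.2 then
        (1 / 2 : ℂ) • (b j + ((-1 : ℂ) ^ γ.1.val) • b j.rev) else 0
    have hp : ∀ γ j, p γ (b j) = if (((j : ℕ) : ℕ) : ZMod 2) = γ.1 + γ.2 then
        (1 / 2 : ℂ) • (b j + ((-1 : ℂ) ^ γ.1.val) • b j.rev) else 0 := fun γ j =>
      Module.Basis.constr_basis b ℂ _ j
    refine isInternal_of_proj _ p ?_ ?_ ?_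
    · intro γ v hv
      induction hv using Submodule.span_induction with
      | mem x hx =>
        obtain ⟨j, hj, rfl⟩ := hx
        rw [hrev, vVec_coe, map_add, map_smul, hp, hp, hpar, if_pos hj, if_pos hj, Fin.rev_rev]
        simp only [smul_add, smul_smul]
        have e : (-1 : ℂ) ^ γ.1.val * (1 / 2) * (-1) ^ γ.1.val = 1 / 2 := by
          linear_combination (1 / 2 : ℂ) * hsq γ.1
        simp only [← mul_assoc, e]
        module
      | zero => simp
      | add x y _ _ hx hy => rw [map_add, hx, hy]
      | smul c x _ hx => rw [map_smul, hx]
    · intro γ δ hne v hv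
      induction hv using Submodule.span_induction with
      | mem x hx =>
        obtain ⟨j, hj, rfl⟩ := hx
        rw [hrev, vVec_coe, map_add, map_smul, hp, hp, hpar, Fin.rev_rev]
        split_ifs with h
        · have e : (-1 : ℂ) ^ δ.1.val * (1 / 2) * (-1) ^ δ.1.val = 1 / 2 := by
            linear_combination (1 / 2 : ℂ) * hsq δ.1
          have hs : ((-1 : ℂ) ^ γ.1.val) = -((-1 : ℂ) ^ δ.1.val) := by
            have h3 : γ.1 + γ.2 = δ.1 + δ.2 := by rw [← hj, h]
            have h4 : γ.1 = δ.1 + 1 := by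
              clear hj h e
              revert γ δ; decide
            rw [h4, neg_one_pow_val_add]
            simp [ZMod.val_one]
          rw [hs]
          simp only [smul_add, smul_smul, ← mul_assoc, neg_mul, e]
          module
        · simp
      | zero => simp
      | add x y _ _ hx hy => rw [map_add, hx, hy, add_zero]
      | smul c x _ hx => rw [map_smul, hx, smul_zero]
    · rw [eq_top_iff, ← b.span_eq, Submodule.span_le]
      rintro _ ⟨j, rfl⟩
      have hmem : ∀ x : ZMod 2, b j + ((-1 : ℂ) ^ x.val) • b j.rev ∈
          ⨆ γ : Gam, Submodule.span ℂ {w | ∃ j : Fin (l + 1),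
            (((j : ℕ) : ℕ) : ZMod 2) = γ.1 + γ.2 ∧
            w = vVec l ((j : ℕ) : ℤ) +
              ((-1 : ℂ) ^ γ.1.val) • vVec l ((l : ℤ) - ((j : ℕ) : ℤ))} := by
        intro x
        refine Submodule.mem_iSup_of_mem ((x, ((j : ℕ) : ZMod 2) - x) : Gam)
          (Submodule.subset_span ⟨j, by simp, ?_⟩)
        rw [hrev, vVec_coe]
      have h := Submodule.smul_mem _ (1 / 2 : ℂ) (Submodule.add_mem _ (hmem 0) (hmem 1))
      have e : (1 / 2 : ℂ) • (b j + ((-1 : ℂ) ^ (0 : ZMod 2).val) • b j.rev +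
          (b j + ((-1 : ℂ) ^ (1 : ZMod 2).val) • b j.rev)) = b j := by
        simp only [ZMod.val_zero, ZMod.val_one, pow_zero, pow_one]
        module
      rw [e] at h
      exact h

/-- The `sl₂ᶜ`-module `(V_l^{E+})^σ`, for `l` even. -/
def vRep (l : ℕ) (hl : Even l) : Slc2 →ₗ[ℂ] Module.End ℂ (VSp l) :=
  recolour sigMult slc2Grading (gradingEPlus l hl) (slRep l)

/-- The vectors `u_j = (v_j + v_{l-j}) + i(-1)^j (v_j - v_{l-j})` of `V_l`; they vanish for
`j = -1` and `j = l + 1`. -/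
def uVec (l : ℕ) (j : ℤ) : VSp l :=
  (vVec l j + vVec l (l - j)) + (Complex.I * (-1) ^ j) • (vVec l j - vVec l (l - j))

/-- The subgroup `{00, 11}` of `ℤ₂ × ℤ₂`. -/
def hTwo : AddSubgroup Gam where
  carrier := {γ | γ = (0, 0) ∨ γ = (1, 1)}
  add_mem' := by
    rintro a b (rfl | rfl) (rfl | rfl)
    · exact Or.inl (by decide)
    · exact Or.inr (by decide)
    · exact Or.inr (by decide)
    · exact Or.inl (by decide)
  zero_mem' := Or.inl rfl
  neg_mem' := by
    rintro a (rfl | rfl)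
    · exact Or.inl (by decide)
    · exact Or.inr (by decide)

/-- The `(ℤ₂ × ℤ₂) ⧸ {00, 11}`-grading of `V_l` giving the graded module `V_l^E`: `v_j` lies in
the sector of `00 + {00, 11}` for `j` even, and of `01 + {00, 11} = 10 + {00, 11}` for `j` odd. -/
def gradingE (l : ℕ) : Grading ℂ (Gam ⧸ hTwo) (VSp l) :=
  Grading.ofBasis (Pi.basisFun ℂ (Fin (l + 1)))
    fun j => (((0, ((j : ℕ) : ZMod 2)) : Gam) : Gam ⧸ hTwo)

theorem coe_eq_coe_iff (γ δ : Gam) :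
    ((γ : Gam ⧸ hTwo) = (δ : Gam ⧸ hTwo)) ↔ γ.1 + γ.2 = δ.1 + δ.2 := by
  rw [QuotientAddGroup.eq]
  change (-γ + δ = (0, 0) ∨ -γ + δ = (1, 1)) ↔ _
  revert γ δ; decide

theorem vVec_mem_gradingE (l : ℕ) (k : ℤ) (γ : Gam) (h : (k : ZMod 2) = γ.1 + γ.2) :
    vVec l k ∈ (gradingE l).sector (γ : Gam ⧸ hTwo) := by
  by_cases hk : 0 ≤ k ∧ k ≤ l
  · obtain ⟨n, rfl⟩ := Int.eq_ofNat_of_zero_le hk.1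
    refine Submodule.subset_span ⟨⟨n, by omega⟩, ?_, ?_⟩
    · rw [coe_eq_coe_iff, ← h]; simp
    · exact vVec_coe l ⟨n, by omega⟩
  · rw [vVec_of_not_mem hk]; exact Submodule.zero_mem _

theorem isGradedAction_gradingE (l : ℕ) :
    IsGradedAction slc2Grading hTwo (gradingE l) (slRep l) := by
  intro α Λ x hx v hv
  obtain rfl | ⟨i, rfl, c, rfl⟩ := exists_of_mem_sector hx
  · simp
  rw [map_smul, LinearMap.smul_apply]
  refine Submodule.smul_mem _ _ ?_
  induction hv using Submodule.span_induction with
  | zero => simp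
  | add v w _ _ hv hw => rw [map_add]; exact Submodule.add_mem _ hv hw
  | smul c v _ hv => rw [map_smul]; exact Submodule.smul_mem _ _ hv
  | mem v hv =>
    obtain ⟨j, rfl, rfl⟩ := hv
    rw [← QuotientAddGroup.mk_add]
    have h1 : ((((j : ℕ) : ℤ) - 1 : ℤ) : ZMod 2) = ((j : ℕ) : ZMod 2) + 1 := by
      push_cast
      generalize ((j : ℕ) : ZMod 2) = y
      revert y; decide
    have h2 : ((((j : ℕ) : ℤ) + 1 : ℤ) : ZMod 2) = ((j : ℕ) : ZMod 2) + 1 := by push_cast; rfl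
    have h3 : ((((j : ℕ) : ℤ) : ℤ) : ZMod 2) = ((j : ℕ) : ZMod 2) := by push_cast; rfl
    rw [slRep, Module.Basis.constr_basis]
    fin_cases i
    · simp only [Fin.zero_eta, Matrix.cons_val_zero, LinearMap.smul_apply, LinearMap.sub_apply,
        eOp, fOp, Module.Basis.constr_basis]
      refine Submodule.smul_mem _ _ (Submodule.sub_mem _ (Submodule.smul_mem _ _ ?_)
        (Submodule.smul_mem _ _ ?_))
      · refine vVec_mem_gradingE l _ _ ?_
        rw [h1]; simp [aDeg, add_comm]
      · refine vVec_mem_gradingE l _ _ ?_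
        rw [h2]; simp [aDeg, add_comm]
    · simp only [Fin.mk_one, Matrix.cons_val_one, Matrix.cons_val_zero, LinearMap.smul_apply,
        LinearMap.add_apply, eOp, fOp, Module.Basis.constr_basis]
      refine Submodule.smul_mem _ _ (Submodule.add_mem _ (Submodule.smul_mem _ _ ?_)
        (Submodule.smul_mem _ _ ?_))
      · refine vVec_mem_gradingE l _ _ ?_
        rw [h1]; simp [aDeg, add_comm]
      · refine vVec_mem_gradingE l _ _ ?_
        rw [h2]; simp [aDeg, add_comm]
    · simp only [Fin.reduceFinMk, Matrix.cons_val, LinearMap.smul_apply, hOp,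
        Module.Basis.constr_basis]
      refine Submodule.smul_mem _ _ (Submodule.smul_mem _ _ ?_)
      refine vVec_mem_gradingE l _ _ ?_
      rw [h3]
      simp only [aDeg, Matrix.cons_val, Prod.fst_add, Prod.snd_add]
      generalize ((j : ℕ) : ZMod 2) = y
      revert y; decide

/-- The vector space underlying the loop module of `V_l^E` by `{00, 11}`. -/
abbrev LoopSp (l : ℕ) : Type := loopSpace hTwo (gradingE l)

/-- The recoloured loop module of `V_l^E` by `{00, 11}`. -/
def loopSigmaRep (l : ℕ) : Slc2 →ₗ[ℂ] Module.End ℂ (LoopSp l) :=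
  recolour sigMult slc2Grading (loopGrading hTwo (gradingE l))
    (loopRep (isGradedAction_gradingE l))

/-- The vector `v_{a,j}` of the loop module: `v_j ⊗ e_γ` where `γ = 00, 01` for `a = 0` and
`j` even, odd, and `γ = 11, 10` for `a = 1` and `j` even, odd. -/
def loopVec (l : ℕ) (a : ZMod 2) (j : ℤ) : LoopSp l :=
  ⟨Finsupp.single ((a, a + (j : ZMod 2)) : Gam) (vVec l j),
    single_mem_loopSpace (vVec_mem_gradingE l j _ (by
      generalize (j : ZMod 2) = y
      revert a y; decide))⟩

/-- The vectors
`u_j^{ζξ} = v_{0,j} + ζ i (-1)^j v_{1,j} + ξ v_{0,l-j} - ζ ξ i (-1)^j v_{1,l-j}`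
of the loop module, for signs `ζ, ξ = ±1`; they vanish for `j = -1`. -/
def uLoopVec (l : ℕ) (ζ ξ : ℤˣ) (j : ℤ) : LoopSp l :=
  loopVec l 0 j + (((ζ : ℤ) : ℂ) * Complex.I * (-1) ^ j) • loopVec l 1 j
    + ((ξ : ℤ) : ℂ) • loopVec l 0 (l - j)
    - (((ζ : ℤ) : ℂ) * ((ξ : ℤ) : ℂ) * Complex.I * (-1) ^ j) • loopVec l 1 (l - j)

/-- The subspace `U_l^{ζξ}` of the loop module, spanned by the `u_j^{ζξ}` for `j = 0, …, (l - 1) / 2`. -/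
def uSpace (l : ℕ) (ζ ξ : ℤˣ) : Submodule ℂ (LoopSp l) :=
  Submodule.span ℂ (Set.range fun j : Fin ((l + 1) / 2) => uLoopVec l ζ ξ ((j : ℕ) : ℤ))

/-- The action on `U_l^{ζξ}` restricted from the recoloured loop module. -/
def uRep (l : ℕ) (ζ ξ : ℤˣ) (h : IsStable (loopSigmaRep l) (uSpace l ζ ξ)) :
    Slc2 →ₗ[ℂ] Module.End ℂ (uSpace l ζ ξ) :=
  subrep (loopSigmaRep l) (uSpace l ζ ξ) h

end ColourSl2

end

/-! A representation amounts to three operators with a₁a₂ + a₂a₁ = a₃ and its cyclic analogues. For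
s = ±1 the operator a₂ + s a₁ reflects eigenvalues of a₃, sending ν to s - ν, so applying the two
signs alternately moves along a ladder of eigenvectors. The identity (a₂ - s a₁)² - (a₂ + s a₁)² =
-2s a₃ takes the place of [e, f] = h. The highest-weight argument for sl₂ then goes through: in
finite dimension the ladder has two ends, and comparing them forces its weight to be a natural
number l. What results is a chain of vectors u_j with a sign ζ (`exists_isChain`).

Reversing a chain, j ↦ l - j, replaces ζ by -(-1)^l ζ (`IsChain.reverse`). For l even the
eigenvalues of a₃ on u_0, …, u_l are distinct and reversal allows the normalisation ζ = 1. For l odd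
the eigenvalues at j and l - j coincide, but the reversed chain has the same ζ, so u_j + ξ u_{l-j}
is again a chain, for either sign ξ; it is determined by its first half.

Both cases are instances of `IsChainBasis`: the first n vectors form a basis and u_n = κ u_{n-1},
with n = l + 1, κ = 0 for l even and n = (l + 1)/2, κ = ξ for l odd. Such a module is irreducible
because a₃ has simple spectrum and the ladder connects all the vectors
(`IsChainBasis.isIrreducibleRep`), and l, ζ, n, κ determine it (`IsChainBasis.isomorphic`). It
remains to find a chain basis in every irreducible module (`IsIrreducibleRep.exists_isChainBasis`)
and in the explicit models (`isChainBasis_uVec`, `isChainBasis_uLoopVec`). The modules are told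
apart by their dimension and by the traces of a₂, which sees κ, and of a₃, which sees ζ. -/

noncomputable section

namespace ColourSl2

/-! ### Chains of a₃-eigenvectors -/

section Chains

variable {V V' : Type*} [AddCommGroup V] [Module ℂ V] [AddCommGroup V'] [Module ℂ V']

/-- The ungraded representations of `sl₂ᶜ` are given by triples of operators satisfying three
anticommutator relations. -/
theorem isUngradedRep_slc2_iff (ρ : Slc2 →ₗ[ℂ] Module.End ℂ V) :
    IsUngradedRep slc2 ρ ↔ ρ a₁ * ρ a₂ + ρ a₂ * ρ a₁ = ρ a₃ ∧
      ρ a₂ * ρ a₃ + ρ a₃ * ρ a₂ = ρ a₁ ∧ ρ a₃ * ρ a₁ + ρ a₁ * ρ a₃ = ρ a₂ := by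
  have hmem : ∀ i, aBasis i ∈ slc2.grading.sector (aDeg i) := fun i =>
    Submodule.subset_span ⟨i, rfl, rfl⟩
  constructor
  · intro h
    have h12 := h _ _ _ (hmem 0) _ (hmem 1)
    have h23 := h _ _ _ (hmem 1) _ (hmem 2)
    have h31 := h _ _ _ (hmem 2) _ (hmem 0)
    have e12 : epsFactor (aDeg 0) (aDeg 1) = -1 := by simp [epsFactor, aDeg, ZMod.val_one]
    have e23 : epsFactor (aDeg 1) (aDeg 2) = -1 := by simp [epsFactor, aDeg, ZMod.val_one]
    have e31 : epsFactor (aDeg 2) (aDeg 0) = -1 := by simp [epsFactor, aDeg, ZMod.val_one]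
    rw [e12, neg_one_smul, sub_neg_eq_add] at h12
    rw [e23, neg_one_smul, sub_neg_eq_add] at h23
    rw [e31, neg_one_smul, sub_neg_eq_add] at h31
    obtain ⟨b12, b23, b31⟩ := slc2Bracket_values
    exact ⟨by rw [← b12]; exact h12.symm, by rw [← b23]; exact h23.symm,
      by rw [← b31]; exact h31.symm⟩
  · rintro ⟨h12, h23, h31⟩ α β x hx y hy
    obtain rfl | ⟨i, rfl, c, rfl⟩ := exists_of_mem_sector hx
    · simp
    obtain rfl | ⟨j, rfl, d, rfl⟩ := exists_of_mem_sector hy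
    · simp
    obtain ⟨b12, b23, b31⟩ := slc2Bracket_values
    have hsymm : ∀ x y, slc2Bracket x y = slc2Bracket y x := by
      intro x y; ext i; fin_cases i <;> simp [slc2Bracket] <;> ring
    have key : ρ (slc2Bracket (aBasis i) (aBasis j)) = ρ (aBasis i) * ρ (aBasis j) -
        epsFactor (aDeg i) (aDeg j) • (ρ (aBasis j) * ρ (aBasis i)) := by
      have hself : ∀ i, slc2Bracket (aBasis i) (aBasis i) = 0 := by
        intro i
        ext k; fin_cases i <;> fin_cases k <;> simp [slc2Bracket, aBasis]
      have eself : ∀ i, epsFactor (aDeg i) (aDeg i) = 1 := by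
        intro i; fin_cases i <;> simp [epsFactor, aDeg]
      have ene : ∀ i j, i ≠ j → epsFactor (aDeg i) (aDeg j) = -1 := by
        intro i j hij
        fin_cases i <;> fin_cases j <;> simp_all [epsFactor, aDeg, ZMod.val_one]
      -- Equal basis vectors impose no condition: the bracket is 0 and ε = 1, so the right-hand side
      -- is a commutator of an operator with itself.
      by_cases hij : i = j
      · subst hij
        rw [hself, eself]; simp
      rw [ene i j hij, neg_one_smul, sub_neg_eq_add]
      fin_cases i <;> fin_cases j <;> first | exact absurd rfl hij | skip
      · exact (congrArg ρ b12).trans h12.symm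
      · exact (congrArg ρ ((hsymm _ _).trans b31)).trans (h31.symm.trans (add_comm _ _))
      · exact (congrArg ρ ((hsymm _ _).trans b12)).trans (h12.symm.trans (add_comm _ _))
      · exact (congrArg ρ b23).trans h23.symm
      · exact (congrArg ρ b31).trans h31.symm
      · exact (congrArg ρ ((hsymm _ _).trans b23)).trans (h23.symm.trans (add_comm _ _))
    change ρ (slc2Bracket _ _) = _
    simp only [map_smul, LinearMap.smul_apply, key, smul_mul_smul_comm]
    module

theorem isStable_of_generators {ρ : Slc2 →ₗ[ℂ] Module.End ℂ V} {U : Submodule ℂ V}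
    (h₁ : ∀ v ∈ U, ρ a₁ v ∈ U) (h₂ : ∀ v ∈ U, ρ a₂ v ∈ U) (h₃ : ∀ v ∈ U, ρ a₃ v ∈ U) :
    IsStable ρ U := by
  intro x v hv
  rw [← aBasis.sum_repr x, Fin.sum_univ_three]
  simp only [map_add, map_smul, LinearMap.add_apply, LinearMap.smul_apply]
  exact U.add_mem (U.add_mem (U.smul_mem _ (h₁ v hv)) (U.smul_mem _ (h₂ v hv)))
    (U.smul_mem _ (h₃ v hv))

/-- A sequence of vectors, indexed by all integers, on which colour `sl₂` acts by the formulas for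
the highest weight `l`, up to the automorphism `a₁ ↦ ζ a₁`, `a₃ ↦ ζ a₃` (where `ζ = ±1`). -/
structure IsChain (ρ : Slc2 →ₗ[ℂ] Module.End ℂ V) (l : ℕ) (ζ : ℂ) (u : ℤ → V) : Prop where
  map_a₁ : ∀ j : ℤ, ρ a₁ (u j) = (-(ζ / 2) * (-1) ^ j) •
    (((l : ℂ) - j + 1) • u (j - 1) - ((j : ℂ) + 1) • u (j + 1))
  map_a₂ : ∀ j : ℤ, ρ a₂ (u j) = (-(1 / 2) : ℂ) •
    (((l : ℂ) - j + 1) • u (j - 1) + ((j : ℂ) + 1) • u (j + 1))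
  map_a₃ : ∀ j : ℤ, ρ a₃ (u j) = (-(ζ / 2) * (-1) ^ j * ((l : ℂ) - 2 * j)) • u j

theorem neg_one_zpow_mul_self (j : ℤ) : (-1 : ℂ) ^ j * (-1) ^ j = 1 := by
  rw [← mul_zpow]; simp

theorem neg_one_zpow_add_one (j : ℤ) : (-1 : ℂ) ^ (j + 1) = -(-1) ^ j := by
  rw [zpow_add_one₀ (by norm_num)]; ring

theorem neg_one_zpow_sub_one (j : ℤ) : (-1 : ℂ) ^ (j - 1) = -(-1) ^ j := by
  rw [zpow_sub_one₀ (by norm_num)]; norm_num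

theorem neg_one_zpow_natCast_sub (l : ℕ) (j : ℤ) :
    (-1 : ℂ) ^ ((l : ℤ) - j) = (-1) ^ l * (-1) ^ j := by
  rw [zpow_sub₀ (by norm_num), zpow_natCast, div_eq_iff (zpow_ne_zero _ (by norm_num)), mul_assoc,
    neg_one_zpow_mul_self, mul_one]

theorem intUnits_cast_mul_self (ζ : ℤˣ) : ((ζ : ℤ) : ℂ) * ((ζ : ℤ) : ℂ) = 1 := by
  rcases Int.units_eq_one_or ζ with rfl | rfl <;> simp

namespace IsChain

variable {ρ : Slc2 →ₗ[ℂ] Module.End ℂ V} {l : ℕ} {ζ : ℂ} {u w : ℤ → V}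

/-- The factor ζ(-1)^j undoes the sign in `map_a₁`, so the u_{j+1} terms cancel. Unlike in sl₂, the
lowering operator depends on the parity of j. -/
theorem lower (h : IsChain ρ l ζ u) (hζ : ζ * ζ = 1) (j : ℤ) :
    ρ a₂ (u j) + (ζ * (-1) ^ j) • ρ a₁ (u j) = -((l : ℂ) - j + 1) • u (j - 1) := by
  rw [h.map_a₁, h.map_a₂, smul_smul]
  have e : ζ * (-1) ^ j * (-(ζ / 2) * (-1) ^ j) = -(1 / 2) := by
    linear_combination (-(1 / 2) * (-1) ^ j * (-1) ^ j) * hζ -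
      (1 / 2) * neg_one_zpow_mul_self j
  rw [e]
  module

theorem raise (h : IsChain ρ l ζ u) (hζ : ζ * ζ = 1) (j : ℤ) :
    ρ a₂ (u j) - (ζ * (-1) ^ j) • ρ a₁ (u j) = -((j : ℂ) + 1) • u (j + 1) := by
  rw [h.map_a₁, h.map_a₂, smul_smul]
  have e : ζ * (-1) ^ j * (-(ζ / 2) * (-1) ^ j) = -(1 / 2) := by
    linear_combination (-(1 / 2) * (-1) ^ j * (-1) ^ j) * hζ -
      (1 / 2) * neg_one_zpow_mul_self j
  rw [e]
  module

theorem add_smul (h : IsChain ρ l ζ u) (h' : IsChain ρ l ζ w) (c : ℂ) :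
    IsChain ρ l ζ fun j => u j + c • w j where
  map_a₁ j := by
    rw [map_add, map_smul, h.map_a₁, h'.map_a₁]; module
  map_a₂ j := by
    rw [map_add, map_smul, h.map_a₂, h'.map_a₂]; module
  map_a₃ j := by
    rw [map_add, map_smul, h.map_a₃, h'.map_a₃]; module

/-- Under j ↦ l - j the coefficients l - j + 1 and j + 1 change places and l - 2j changes sign; so
a₂ keeps its formula, while a₁ and a₃ acquire -1 together with the (-1)^l from (-1)^(l-j). For l
odd, ζ is unchanged. -/
theorem reverse (h : IsChain ρ l ζ u) :
    IsChain ρ l (-(-1) ^ l * ζ) fun j => u (l - j) where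
  map_a₁ j := by
    rw [h.map_a₁, neg_one_zpow_natCast_sub, show (l : ℤ) - j - 1 = l - (j + 1) by ring,
      show (l : ℤ) - j + 1 = l - (j - 1) by ring]
    push_cast
    module
  map_a₂ j := by
    rw [h.map_a₂, show (l : ℤ) - j - 1 = l - (j + 1) by ring,
      show (l : ℤ) - j + 1 = l - (j - 1) by ring]
    push_cast
    module
  map_a₃ j := by
    rw [h.map_a₃, neg_one_zpow_natCast_sub]
    push_cast
    module

/-- Comparison of coefficients. In the first relation the u_{j±2} terms cancel because the sign
(-1)^j in a₁ flips between neighbours; only the third relation needs ζ² = 1. -/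
theorem anticomm (h : IsChain ρ l ζ u) (hζ : ζ * ζ = 1) (j : ℤ) :
    ρ a₁ (ρ a₂ (u j)) + ρ a₂ (ρ a₁ (u j)) = ρ a₃ (u j) ∧
    ρ a₂ (ρ a₃ (u j)) + ρ a₃ (ρ a₂ (u j)) = ρ a₁ (u j) ∧
    ρ a₃ (ρ a₁ (u j)) + ρ a₁ (ρ a₃ (u j)) = ρ a₂ (u j) := by
  have hz : ζ * ζ * ((-1 : ℂ) ^ j * (-1) ^ j) = 1 := by rw [hζ, neg_one_zpow_mul_self, mul_one]
  simp only [h.map_a₁, h.map_a₂, h.map_a₃, map_smul, map_add, map_sub, neg_one_zpow_add_one,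
    neg_one_zpow_sub_one, sub_add_cancel, add_sub_cancel_right]
  push_cast
  refine ⟨by module, by module, ?_⟩
  match_scalars
  · linear_combination (-(1 / 2) * ((l : ℂ) - j + 1)) * hz
  · linear_combination (-(1 / 2) * ((j : ℂ) + 1)) * hz

theorem isUngradedRep (h : IsChain ρ l ζ u) (hζ : ζ * ζ = 1)
    (hspan : Submodule.span ℂ (Set.range u) = ⊤) : IsUngradedRep slc2 ρ := by
  rw [isUngradedRep_slc2_iff]
  refine ⟨?_, ?_, ?_⟩ <;> refine LinearMap.ext_on_range hspan fun j => ?_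
  · exact (h.anticomm hζ j).1
  · exact (h.anticomm hζ j).2.1
  · exact (h.anticomm hζ j).2.2

/-- Lowering u_{j+1} gives u_j with the coefficient -(l - j), nonzero for j < l, so a vanishing
vector would propagate down to u_0. -/
theorem ne_zero (h : IsChain ρ l ζ u) (hζ : ζ * ζ = 1) (h0 : u 0 ≠ 0) (j : ℕ) (hj : j ≤ l) :
    u j ≠ 0 := by
  induction j with
  | zero => exact h0
  | succ j ih =>
    intro hz
    have := h.lower hζ ((j + 1 : ℕ) : ℤ)
    rw [hz, map_zero, map_zero, smul_zero, add_zero, eq_comm, smul_eq_zero] at this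
    rcases this with h1 | h1
    · rw [neg_eq_zero] at h1
      push_cast at h1
      have h2 : (l : ℂ) = j := by linear_combination h1
      have := Nat.cast_injective h2
      omega
    · refine ih (by omega) ?_
      rw [← h1]; congr 1; push_cast; ring

/-- The eigenvalues of `a₃` along an initial segment of a chain are distinct. -/
theorem eigenvalue_injective {n : ℕ} (hζ : ζ * ζ = 1) (hn : Even l ∨ 2 * n ≤ l + 1) :
    Function.Injective fun j : Fin n => -(ζ / 2) * (-1) ^ ((j : ℕ) : ℤ) *
      ((l : ℂ) - 2 * (((j : ℕ) : ℤ) : ℂ)) := by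
  intro j k hjk
  have hζ0 : ζ ≠ 0 := by rintro rfl; simp at hζ
  have h1 : (-1 : ℂ) ^ (j : ℕ) * ((l : ℂ) - 2 * (j : ℕ)) =
      (-1 : ℂ) ^ (k : ℕ) * ((l : ℂ) - 2 * (k : ℕ)) := by
    have : -(ζ / 2) ≠ 0 := by simpa using hζ0
    refine mul_left_cancel₀ this ?_
    simp only [zpow_natCast, Int.cast_natCast] at hjk
    linear_combination hjk
  have h2 : (-1 : ℤ) ^ (j : ℕ) * ((l : ℤ) - 2 * (j : ℕ)) =
      (-1 : ℤ) ^ (k : ℕ) * ((l : ℤ) - 2 * (k : ℕ)) := by exact_mod_cast h1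
  ext
  have hj := j.2
  have hk := k.2
  -- Equal parities give j = k. Opposite parities give j + k = l: impossible by parity if l is even,
  -- and by j + k ≤ 2n - 2 < l otherwise.
  rcases Nat.even_or_odd (j : ℕ) with ej | ej <;> rcases Nat.even_or_odd (k : ℕ) with ek | ek <;>
    rw [ej.neg_one_pow, ek.neg_one_pow] at h2 <;>
    rcases hn with ⟨r, hr⟩ | hn <;> obtain ⟨s, hs⟩ := ej <;> obtain ⟨t, ht⟩ := ek <;> omega

theorem linearIndependent {n : ℕ} (h : IsChain ρ l ζ u) (hζ : ζ * ζ = 1) (h0 : u 0 ≠ 0)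
    (hn : n ≤ l + 1) (hn' : Even l ∨ 2 * n ≤ l + 1) :
    LinearIndependent ℂ fun j : Fin n => u ((j : ℕ) : ℤ) :=
  Module.End.eigenvectors_linearIndependent' (ρ a₃) _ (eigenvalue_injective hζ hn') _ fun j =>
    ⟨Module.End.mem_eigenspace_iff.2 (h.map_a₃ _), h.ne_zero hζ h0 _ (by omega)⟩

/-- From indices 0, …, n - 1 the generators reach at most one step further, so only u_{-1} and u_n
have to be checked in addition. -/
theorem isStable_of_mem (h : IsChain ρ l ζ u) {n : ℕ} {U : Submodule ℂ V}
    (hU : U = Submodule.span ℂ (Set.range fun j : Fin n => u ((j : ℕ) : ℤ)))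
    (hmem : ∀ j : ℤ, -1 ≤ j → j ≤ n → u j ∈ U) : IsStable ρ U := by
  have key : ∀ T : Module.End ℂ V, (∀ j : ℕ, j < n → T (u j) ∈ U) → ∀ v ∈ U, T v ∈ U := by
    intro T hT v hv
    have : U ≤ U.comap T := by
      conv_lhs => rw [hU]
      rw [Submodule.span_le]
      rintro _ ⟨j, rfl⟩
      exact hT _ j.2
    exact this hv
  refine isStable_of_generators (key _ fun j hj => ?_) (key _ fun j hj => ?_)
    (key _ fun j hj => ?_)
  · rw [h.map_a₁]
    exact U.smul_mem _ (U.sub_mem (U.smul_mem _ (hmem _ (by omega) (by omega)))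
      (U.smul_mem _ (hmem _ (by omega) (by omega))))
  · rw [h.map_a₂]
    exact U.smul_mem _ (U.add_mem (U.smul_mem _ (hmem _ (by omega) (by omega)))
      (U.smul_mem _ (hmem _ (by omega) (by omega))))
  · rw [h.map_a₃]
    exact U.smul_mem _ (hmem _ (by omega) (by omega))

end IsChain

/-! ### Chain bases: irreducibility, uniqueness and traces -/

/-- A chain whose first `n` vectors form a basis, with `u_n = κ u_{n-1}`. -/
structure IsChainBasis (ρ : Slc2 →ₗ[ℂ] Module.End ℂ V) (l : ℕ) (ζ : ℂ) (n : ℕ) (κ : ℂ)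
    (u : ℤ → V) : Prop extends IsChain ρ l ζ u where
  sq_eq_one : ζ * ζ = 1
  apply_zero_ne : u 0 ≠ 0
  apply_neg_one : u (-1) = 0
  apply_last : u n = κ • u ((n : ℤ) - 1)
  pos : 0 < n
  le : n ≤ l + 1
  even_or_le : Even l ∨ 2 * n ≤ l + 1
  span_eq_top : Submodule.span ℂ (Set.range fun j : Fin n => u ((j : ℕ) : ℤ)) = ⊤

/-- Splitting off the first term 2m + 1 leaves minus the previous sum, and (2m + 1) - m = m + 1.
This evaluates the trace of a₃ for l = 2m - 1. -/
theorem sum_range_alternating (m : ℕ) :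
    ∑ j ∈ Finset.range m, (-1 : ℂ) ^ j * (((2 * m : ℕ) : ℂ) - 1 - 2 * j) = m := by
  induction m with
  | zero => simp
  | succ m ih =>
    have h : ∑ j ∈ Finset.range m, (-1 : ℂ) ^ (j + 1) *
        (((2 * (m + 1) : ℕ) : ℂ) - 1 - 2 * ((j + 1 : ℕ) : ℂ)) = -m := by
      rw [← ih, ← Finset.sum_neg_distrib]
      refine Finset.sum_congr rfl fun j _ => ?_
      push_cast
      ring
    rw [Finset.sum_range_succ', h]
    push_cast
    ring

namespace IsChainBasis

variable {ρ : Slc2 →ₗ[ℂ] Module.End ℂ V} {ρ' : Slc2 →ₗ[ℂ] Module.End ℂ V'} {l n : ℕ} {ζ κ : ℂ}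
  {u : ℤ → V} {u' : ℤ → V'}

/-- The basis given by the first `n` vectors of the chain. -/
def basis (h : IsChainBasis ρ l ζ n κ u) : Module.Basis (Fin n) ℂ V :=
  Module.Basis.mk (h.toIsChain.linearIndependent h.sq_eq_one h.apply_zero_ne h.le h.even_or_le)
    h.span_eq_top.ge

theorem basis_apply (h : IsChainBasis ρ l ζ n κ u) (j : Fin n) :
    h.basis j = u ((j : ℕ) : ℤ) := by simp [basis]

theorem finrank (h : IsChainBasis ρ l ζ n κ u) : Module.finrank ℂ V = n := by
  rw [Module.finrank_eq_card_basis h.basis, Fintype.card_fin]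

theorem isUngradedRep (h : IsChainBasis ρ l ζ n κ u) : IsUngradedRep slc2 ρ := by
  refine h.toIsChain.isUngradedRep h.sq_eq_one (top_unique ?_)
  rw [← h.span_eq_top]
  refine Submodule.span_mono ?_
  rintro _ ⟨j, rfl⟩
  exact ⟨_, rfl⟩

/-- A nonzero stable subspace contains an eigenvector of a₃. The spectrum on the basis is simple, so
this is a multiple of one u_k; lowering reaches u_0, and raising then reaches every u_j. -/
theorem isIrreducibleRep (h : IsChainBasis ρ l ζ n κ u) : IsIrreducibleRep ρ := by
  refine ⟨⟨u 0, 0, h.apply_zero_ne⟩, fun U hU => ?_⟩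
  rw [or_iff_not_imp_left]
  intro hne
  have hfin : FiniteDimensional ℂ V := Module.Finite.of_basis h.basis
  have : Nontrivial U := Submodule.nontrivial_iff_ne_bot.2 hne
  obtain ⟨μ, hμ⟩ := Module.End.exists_eigenvalue ((ρ a₃).restrict (hU a₃))
  obtain ⟨v, hv⟩ := hμ.exists_hasEigenvector
  have hv3 : ρ a₃ v = μ • (v : V) := congrArg Subtype.val hv.apply_eq_smul
  have hv0 : (v : V) ≠ 0 := fun h0 => hv.2 (Subtype.ext h0)
  set m : Fin n → ℂ := fun j => -(ζ / 2) * (-1) ^ ((j : ℕ) : ℤ) *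
      ((l : ℂ) - 2 * (((j : ℕ) : ℤ) : ℂ))
  have hinj : Function.Injective m := IsChain.eigenvalue_injective h.sq_eq_one h.even_or_le
  have hcoord : ∀ j, h.basis.repr v j * m j = μ * h.basis.repr v j := by
    have h1 : ∑ j, (h.basis.repr v j * m j) • h.basis j =
        ∑ j, (μ * h.basis.repr v j) • h.basis j := by
      have e1 : ρ a₃ v = ∑ j, (h.basis.repr v j * m j) • h.basis j := by
        conv_lhs => rw [← h.basis.sum_repr v, map_sum]
        refine Finset.sum_congr rfl fun j _ => ?_
        rw [map_smul, h.basis_apply, h.map_a₃, smul_smul]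
      have e2 : μ • (v : V) = ∑ j, (μ * h.basis.repr v j) • h.basis j := by
        conv_lhs => rw [← h.basis.sum_repr v, Finset.smul_sum]
        simp only [smul_smul]
      rw [← e1, ← e2, hv3]
    intro j
    have := congrArg (fun x => ⇑(h.basis.repr x)) h1
    simp only [Module.Basis.repr_sum_self] at this
    exact congrFun this j
  obtain ⟨k, hk⟩ : ∃ k, h.basis.repr v k ≠ 0 := by
    by_contra! hall
    exact hv0 (h.basis.ext_elem fun j => by simp [hall j])
  have hother : ∀ j, j ≠ k → h.basis.repr v j = 0 := by
    intro j hj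
    by_contra hj0
    have e1 : m j = μ := mul_left_cancel₀ hj0 (by rw [hcoord j, mul_comm])
    have e2 : m k = μ := mul_left_cancel₀ hk (by rw [hcoord k, mul_comm])
    exact hj (hinj (e1.trans e2.symm))
  have hvk : (v : V) = h.basis.repr v k • u ((k : ℕ) : ℤ) := by
    conv_lhs => rw [← h.basis.sum_repr v]
    rw [Finset.sum_eq_single k, h.basis_apply]
    · intro j _ hj; rw [hother j hj, zero_smul]
    · simp
  have huk : u ((k : ℕ) : ℤ) ∈ U := (U.smul_mem_iff hk).1 (hvk ▸ v.2)
  -- The bound j ≤ l keeps the lowering coefficients nonzero. Raising below needs no bound, since j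
  -- + 1 never vanishes.
  have hdown : ∀ j : ℕ, j ≤ l → u (j : ℤ) ∈ U → u 0 ∈ U := by
    intro j
    induction j with
    | zero => intro _ h0; exact h0
    | succ j ih =>
      intro hj hmem
      refine ih (by omega) ?_
      have hl := h.lower h.sq_eq_one ((j + 1 : ℕ) : ℤ)
      have hm : -((l : ℂ) - (((j + 1 : ℕ) : ℤ) : ℂ) + 1) • u (((j + 1 : ℕ) : ℤ) - 1) ∈ U := by
        rw [← hl]
        exact U.add_mem (hU _ _ hmem) (U.smul_mem _ (hU _ _ hmem))
      rw [U.smul_mem_iff] at hm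
      · convert hm using 2; push_cast; ring
      · push_cast
        intro h0
        have h2 : (l : ℂ) = j := by linear_combination -h0
        have := Nat.cast_injective h2
        omega
  have hup : ∀ j : ℕ, u (j : ℤ) ∈ U := by
    intro j
    induction j with
    | zero => exact hdown k (by have := k.2; have := h.le; omega) huk
    | succ j ih =>
      have hl := h.raise h.sq_eq_one (j : ℤ)
      have hm : -(((j : ℤ) : ℂ) + 1) • u ((j : ℤ) + 1) ∈ U := by
        rw [← hl]
        exact U.sub_mem (hU _ _ ih) (U.smul_mem _ (hU _ _ ih))
      rw [U.smul_mem_iff] at hm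
      · exact_mod_cast hm
      · rw [neg_ne_zero]
        exact_mod_cast Nat.succ_ne_zero j
  rw [eq_top_iff, ← h.span_eq_top, Submodule.span_le]
  rintro _ ⟨j, rfl⟩
  exact hup j

/-- The constants `l`, `ζ`, `n`, `κ` determine the module. -/
theorem isomorphic (h : IsChainBasis ρ l ζ n κ u) (h' : IsChainBasis ρ' l ζ n κ u') :
    Isomorphic ρ ρ' := by
  set φ := h.basis.equiv h'.basis (Equiv.refl _) with hφ
  have hlt : ∀ j : ℕ, j < n → φ (u j) = u' j := by
    intro j hj
    have := h.basis.equiv_apply ⟨j, hj⟩ h'.basis (Equiv.refl _)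
    rwa [h.basis_apply, Equiv.refl_apply, h'.basis_apply] at this
  -- u_n is not a basis vector, but a₁ and a₂ reach it from u_{n-1}; the common κ is what makes φ
  -- match it.
  have hn : φ (u n) = u' n := by
    obtain ⟨m, rfl⟩ := Nat.exists_eq_succ_of_ne_zero h.pos.ne'
    have e : (((m + 1 : ℕ) : ℤ) - 1) = (m : ℤ) := by push_cast; ring
    rw [h.apply_last, h'.apply_last, map_smul, Nat.succ_eq_add_one, e, hlt m (by omega)]
  have hsub : ∀ j : ℕ, j < n → φ (u (j - 1)) = u' (j - 1) := by
    intro j hj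
    cases j with
    | zero => simp [h.apply_neg_one, h'.apply_neg_one]
    | succ j =>
      have e : (((j + 1 : ℕ) : ℤ) - 1) = (j : ℤ) := by push_cast; ring
      rw [e, hlt j (by omega)]
  have hadd : ∀ j : ℕ, j < n → φ (u (j + 1)) = u' (j + 1) := by
    intro j hj
    rcases Nat.lt_or_ge (j + 1) n with h1 | h1
    · exact_mod_cast hlt _ h1
    · obtain rfl : n = j + 1 := by omega
      exact_mod_cast hn
  have key : ∀ x, φ.toLinearMap ∘ₗ ρ x = ρ' x ∘ₗ φ.toLinearMap := by
    intro x
    have h1 : φ.toLinearMap ∘ₗ ρ a₁ = ρ' a₁ ∘ₗ φ.toLinearMap := by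
      refine h.basis.ext fun j => ?_
      simp [h.basis_apply, hlt j j.2, h.map_a₁, h'.map_a₁, hsub j j.2, hadd j j.2]
    have h2 : φ.toLinearMap ∘ₗ ρ a₂ = ρ' a₂ ∘ₗ φ.toLinearMap := by
      refine h.basis.ext fun j => ?_
      simp [h.basis_apply, hlt j j.2, h.map_a₂, h'.map_a₂, hsub j j.2, hadd j j.2]
    have h3 : φ.toLinearMap ∘ₗ ρ a₃ = ρ' a₃ ∘ₗ φ.toLinearMap := by
      refine h.basis.ext fun j => ?_
      simp [h.basis_apply, hlt j j.2, h.map_a₃, h'.map_a₃]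
    rw [← aBasis.sum_repr x, Fin.sum_univ_three]
    simp only [map_add, map_smul, LinearMap.comp_add, LinearMap.add_comp, LinearMap.comp_smul,
      LinearMap.smul_comp]
    change _ • (_ ∘ₗ ρ a₁) + _ • (_ ∘ₗ ρ a₂) + _ • (_ ∘ₗ ρ a₃) = _
    rw [h1, h2, h3]
    rfl
  exact ⟨φ, fun x v => LinearMap.congr_fun (key x) v⟩

theorem basis_repr_apply_self (h : IsChainBasis ρ l ζ n κ u) (j : Fin n) (k : ℕ) (hk : k < n) :
    h.basis.repr (u k) j = if k = j then 1 else 0 := by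
  have := h.basis.repr_self_apply ⟨k, hk⟩ j
  rw [h.basis_apply] at this
  simpa [Fin.ext_iff] using this

/-- a₃ is diagonal in the chain basis, so this is -ζ/2 times the alternating sum. It recovers ζ from
the module. -/
theorem trace_a₃ (h : IsChainBasis ρ l ζ n κ u) (hl : l + 1 = 2 * n) :
    LinearMap.trace ℂ V (ρ a₃) = -(ζ / 2) * n := by
  rw [LinearMap.trace_eq_matrix_trace ℂ h.basis, Matrix.trace, ← sum_range_alternating,
    Finset.mul_sum, ← Fin.sum_univ_eq_sum_range
      (fun j => -(ζ / 2) * ((-1) ^ j * (((2 * n : ℕ) : ℂ) - 1 - 2 * j)))]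
  refine Finset.sum_congr rfl fun j _ => ?_
  rw [Matrix.diag_apply, LinearMap.toMatrix_apply, h.basis_apply, h.map_a₃, map_smul,
    Finsupp.smul_apply, h.basis_repr_apply_self j j j.2, ← hl]
  simp [mul_assoc]

/-- a₂ moves the index by one, so the only diagonal entry that can be nonzero is the last, where n
u_n = nκ u_{n-1}. The trace recovers κ. -/
theorem trace_a₂ (h : IsChainBasis ρ l ζ n κ u) : LinearMap.trace ℂ V (ρ a₂) =
    -(κ * n / 2) := by
  rw [LinearMap.trace_eq_matrix_trace ℂ h.basis, Matrix.trace]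
  have hpos := h.pos
  have hsub : ∀ j : Fin n, h.basis.repr (u (((j : ℕ) : ℤ) - 1)) j = 0 := by
    rintro ⟨j, hj⟩
    cases j with
    | zero => simp [h.apply_neg_one]
    | succ j =>
      have e : (((j + 1 : ℕ) : ℤ) - 1) = (j : ℤ) := by push_cast; ring
      simp only [e]
      rw [h.basis_repr_apply_self _ j (by omega)]
      simp
  have hadd : ∀ j : Fin n, h.basis.repr (u (((j : ℕ) : ℤ) + 1)) j =
      if (j : ℕ) = n - 1 then κ else 0 := by
    rintro ⟨j, hj⟩
    have e : (((j : ℕ) : ℤ) + 1) = ((j + 1 : ℕ) : ℤ) := by push_cast; ring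
    simp only [e]
    split_ifs with h1
    · obtain rfl : n = j + 1 := by omega
      have e : (((j + 1 : ℕ) : ℤ) - 1) = (j : ℤ) := by push_cast; ring
      rw [h.apply_last, e, map_smul, Finsupp.smul_apply, h.basis_repr_apply_self _ j (by omega)]
      simp
    · rw [h.basis_repr_apply_self _ (j + 1) (by omega)]
      simp
  rw [Finset.sum_eq_single ⟨n - 1, by omega⟩]
  · rw [Matrix.diag_apply, LinearMap.toMatrix_apply, h.basis_apply, h.map_a₂]
    have hs := hsub ⟨n - 1, by omega⟩
    have ha := hadd ⟨n - 1, by omega⟩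
    have e : ((n - 1 : ℕ) : ℂ) = n - 1 := by push_cast [Nat.cast_sub hpos]; ring
    rw [if_pos rfl] at ha
    simp only [map_smul, map_add, Finsupp.smul_apply, Finsupp.add_apply, hs, ha, smul_eq_mul,
      Int.cast_natCast, e]
    ring
  · intro j _ hj
    have hj' : (j : ℕ) ≠ n - 1 := fun h0 => hj (Fin.ext h0)
    rw [Matrix.diag_apply, LinearMap.toMatrix_apply, h.basis_apply, h.map_a₂]
    simp [hsub, hadd, hj']
  · simp

end IsChainBasis

theorem Isomorphic.finrank_eq {ρ : Slc2 →ₗ[ℂ] Module.End ℂ V} {ρ' : Slc2 →ₗ[ℂ] Module.End ℂ V'}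
    (h : Isomorphic ρ ρ') : Module.finrank ℂ V = Module.finrank ℂ V' :=
  let ⟨φ, _⟩ := h
  φ.finrank_eq

theorem Isomorphic.trace_eq {ρ : Slc2 →ₗ[ℂ] Module.End ℂ V} {ρ' : Slc2 →ₗ[ℂ] Module.End ℂ V'}
    (h : Isomorphic ρ ρ') (x : Slc2) :
    LinearMap.trace ℂ V (ρ x) = LinearMap.trace ℂ V' (ρ' x) := by
  obtain ⟨φ, hφ⟩ := h
  rw [← LinearMap.trace_conj' (ρ x) φ]
  congr 1
  ext v
  simp [LinearEquiv.conj_apply, hφ]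

end Chains

/-! ### The explicit modules and their chain bases -/

section Models

/-- A double sequence of vectors, on which colour `sl₂` acts as on the recoloured graded modules. -/
structure IsDoubleChain {V : Type*} [AddCommGroup V] [Module ℂ V]
    (ρ : Slc2 →ₗ[ℂ] Module.End ℂ V) (l : ℕ) (w : ZMod 2 → ℤ → V) : Prop where
  map_a₁ : ∀ a j, ρ a₁ (w a j) = (Complex.I / 2) •
    (((l : ℂ) - j + 1) • w (a + 1) (j - 1) - ((j : ℂ) + 1) • w (a + 1) (j + 1))
  map_a₂ : ∀ a j, ρ a₂ (w a j) = (-(1 / 2) * (-1) ^ a.val : ℂ) •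
    (((l : ℂ) - j + 1) • w a (j - 1) + ((j : ℂ) + 1) • w a (j + 1))
  map_a₃ : ∀ a j, ρ a₃ (w a j) =
    (-(Complex.I / 2) * (-1) ^ a.val * ((l : ℂ) - 2 * j)) • w (a + 1) j

/-- On the plane of w_{0,j} and w_{1,j} the operator a₃ interchanges the two lines, and w_{0,j} ± i
w_{1,j} are eigenvectors. The sign has to alternate with j, since a₂ acts on the two rows with
opposite signs while shifting j by one. -/
theorem IsDoubleChain.isChain {V : Type*} [AddCommGroup V] [Module ℂ V]
    {ρ : Slc2 →ₗ[ℂ] Module.End ℂ V} {l : ℕ} {w : ZMod 2 → ℤ → V} (h : IsDoubleChain ρ l w)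
    {ζ : ℂ} (hζ : ζ * ζ = 1) :
    IsChain ρ l ζ fun j => w 0 j + (ζ * Complex.I * (-1) ^ j) • w 1 j := by
  have h11 : (1 + 1 : ZMod 2) = 0 := by decide
  have hI := Complex.I_mul_I
  constructor <;> intro j
  · rw [map_add, map_smul, h.map_a₁, h.map_a₁, h11, zero_add, neg_one_zpow_add_one,
      neg_one_zpow_sub_one]
    have e := neg_one_zpow_mul_self j
    generalize (-1 : ℂ) ^ j = s at e ⊢
    have h1 : ζ * Complex.I * s * (Complex.I / 2) = -(ζ / 2) * s := by
      linear_combination (ζ * s / 2) * hI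
    have h2 : -(ζ / 2) * s * (ζ * Complex.I * -s) = Complex.I / 2 := by
      linear_combination (Complex.I / 2 * (s * s)) * hζ + Complex.I / 2 * e
    rw [smul_smul, h1]
    match_scalars
    · linear_combination (-((l : ℂ) - j + 1)) * h2
    · linear_combination ((j : ℂ) + 1) * h2
    · ring
    · ring
  · rw [map_add, map_smul, h.map_a₂, h.map_a₂, neg_one_zpow_add_one,
      neg_one_zpow_sub_one, ZMod.val_zero, ZMod.val_one]
    module
  · rw [map_add, map_smul, h.map_a₃, h.map_a₃, h11, zero_add, ZMod.val_zero, ZMod.val_one]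
    have e := neg_one_zpow_mul_self j
    generalize (-1 : ℂ) ^ j = s at e ⊢
    match_scalars
    · linear_combination (Complex.I / 2 * ((l : ℂ) - 2 * j)) * (s * s * hζ + e)
    · linear_combination (ζ * s / 2 * ((l : ℂ) - 2 * j)) * hI

/-- Valid for every integer k: outside 0, …, l the vector on the right vanishes too, except at k = l
+ 1, where its coefficient does. -/
theorem eOp_vVec (l : ℕ) (k : ℤ) :
    eOp l (vVec l k) = ((l : ℂ) - k + 1) • vVec l (k - 1) := by
  by_cases hk : 0 ≤ k ∧ k ≤ l
  · obtain ⟨n, rfl⟩ := Int.eq_ofNat_of_zero_le hk.1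
    have hn : n < l + 1 := by omega
    have := vVec_coe l ⟨n, hn⟩
    simp only at this
    rw [this, eOp, Module.Basis.constr_basis]
    simp
  · rw [vVec_of_not_mem hk, map_zero, eq_comm, smul_eq_zero]
    by_cases h1 : k = l + 1
    · left; rw [h1]; push_cast; ring
    · right; exact vVec_of_not_mem (by omega)

theorem fOp_vVec (l : ℕ) (k : ℤ) : fOp l (vVec l k) = ((k : ℂ) + 1) • vVec l (k + 1) := by
  by_cases hk : 0 ≤ k ∧ k ≤ l
  · obtain ⟨n, rfl⟩ := Int.eq_ofNat_of_zero_le hk.1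
    have hn : n < l + 1 := by omega
    have := vVec_coe l ⟨n, hn⟩
    simp only at this
    rw [this, fOp, Module.Basis.constr_basis]
    simp
  · rw [vVec_of_not_mem hk, map_zero, eq_comm, smul_eq_zero]
    by_cases h1 : k = -1
    · left; rw [h1]; push_cast; ring
    · right; exact vVec_of_not_mem (by omega)

theorem hOp_vVec (l : ℕ) (k : ℤ) : hOp l (vVec l k) = ((l : ℂ) - 2 * k) • vVec l k := by
  by_cases hk : 0 ≤ k ∧ k ≤ l
  · obtain ⟨n, rfl⟩ := Int.eq_ofNat_of_zero_le hk.1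
    have hn : n < l + 1 := by omega
    have := vVec_coe l ⟨n, hn⟩
    simp only at this
    conv_lhs => rw [this]
    rw [hOp, Module.Basis.constr_basis]
    simp
  · rw [vVec_of_not_mem hk, map_zero, smul_zero]

theorem slRep_a₁ (l : ℕ) : slRep l a₁ = (Complex.I / 2) • (eOp l - fOp l) :=
  Module.Basis.constr_basis _ _ _ _

theorem slRep_a₂ (l : ℕ) : slRep l a₂ = (-(1 / 2) : ℂ) • (eOp l + fOp l) :=
  Module.Basis.constr_basis _ _ _ _

theorem slRep_a₃ (l : ℕ) : slRep l a₃ = (-(Complex.I / 2)) • hOp l :=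
  Module.Basis.constr_basis _ _ _ _

theorem a₁_mem_sector : a₁ ∈ slc2Grading.sector (1, 0) := Submodule.subset_span ⟨0, rfl, rfl⟩

theorem a₂_mem_sector : a₂ ∈ slc2Grading.sector (0, 1) := Submodule.subset_span ⟨1, rfl, rfl⟩

theorem a₃_mem_sector : a₃ ∈ slc2Grading.sector (1, 1) := Submodule.subset_span ⟨2, rfl, rfl⟩

/-- The vectors `v_k ± v_{l-k}`. -/
def symVec (l : ℕ) (a : ZMod 2) (k : ℤ) : VSp l :=
  vVec l k + ((-1 : ℂ) ^ a.val) • vVec l (l - k)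

theorem symVec_mem (l : ℕ) (hl : Even l) (a : ZMod 2) (k : ℤ) :
    symVec l a k ∈ (gradingEPlus l hl).sector (a, a + (k : ZMod 2)) := by
  by_cases hk : 0 ≤ k ∧ k ≤ l
  · obtain ⟨n, rfl⟩ := Int.eq_ofNat_of_zero_le hk.1
    refine Submodule.subset_span ⟨⟨n, by omega⟩, ?_, rfl⟩
    simp only [Int.cast_natCast]
    generalize (n : ZMod 2) = y
    revert a y; decide
  · rw [symVec, vVec_of_not_mem hk, vVec_of_not_mem (by omega), smul_zero, add_zero]
    exact Submodule.zero_mem _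

theorem neg_one_pow_val_add_one (a : ZMod 2) : (-1 : ℂ) ^ (a + 1).val = -(-1) ^ a.val := by
  rw [neg_one_pow_val_add, ZMod.val_one]; ring

/-- The reflection v_j ↦ v_{l-j} exchanges e and f and negates h. So a₁ and a₃ interchange symmetric
and antisymmetric vectors and a₂ preserves each kind; σ supplies the signs (-1)^a for a₂ and a₃. -/
theorem isDoubleChain_symVec (l : ℕ) (hl : Even l) :
    IsDoubleChain (vRep l hl) l (symVec l) := by
  constructor <;> intro a j
  · rw [vRep, recolour_apply_of_mem _ _ _ _ a₁_mem_sector (symVec_mem l hl a j), slRep_a₁]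
    simp only [symVec, LinearMap.smul_apply, LinearMap.sub_apply, map_add, map_smul, eOp_vVec,
      fOp_vVec, neg_one_pow_val_add_one, sigMult, zero_mul, ZMod.val_zero, pow_zero, one_smul]
    rw [show (l : ℤ) - (j - 1) = l - j + 1 by ring, show (l : ℤ) - (j + 1) = l - j - 1 by ring]
    push_cast
    module
  · rw [vRep, recolour_apply_of_mem _ _ _ _ a₂_mem_sector (symVec_mem l hl a j), slRep_a₂]
    simp only [symVec, LinearMap.smul_apply, LinearMap.add_apply, map_add, map_smul, eOp_vVec,
      fOp_vVec, sigMult, one_mul]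
    rw [show (l : ℤ) - (j - 1) = l - j + 1 by ring, show (l : ℤ) - (j + 1) = l - j - 1 by ring]
    push_cast
    module
  · rw [vRep, recolour_apply_of_mem _ _ _ _ a₃_mem_sector (symVec_mem l hl a j), slRep_a₃]
    simp only [symVec, LinearMap.smul_apply, map_add, map_smul, hOp_vVec,
      neg_one_pow_val_add_one, sigMult, one_mul]
    push_cast
    module

theorem uVec_of_not_mem {l : ℕ} {k : ℤ} (h : ¬ (0 ≤ k ∧ k ≤ l)) : uVec l k = 0 := by
  rw [uVec, vVec_of_not_mem h, vVec_of_not_mem (by omega)]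
  simp

theorem isChainBasis_uVec (l : ℕ) (hl : Even l) :
    IsChainBasis (vRep l hl) l 1 (l + 1) 0 (uVec l) := by
  have hc : IsChain (vRep l hl) l 1 (uVec l) := by
    convert! (isDoubleChain_symVec l hl).isChain (one_mul 1) using 2 with j
    simp only [uVec, symVec, ZMod.val_zero, ZMod.val_one]
    module
  have h0 : uVec l 0 ≠ 0 := by
    intro h
    -- The v_0-coordinate is 1 + i for l > 0 and 2 for l = 0, so its real part is nonzero in both
    -- cases.
    have h1 := congrArg Complex.re (congrFun h 0)
    by_cases hl0 : l = 0
    · subst hl0; simp [uVec, vVec] at h1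
    · have : (0 : ℤ) ≠ l := by omega
      simp [uVec, vVec, this] at h1
  exact
    { hc with
      sq_eq_one := one_mul 1
      apply_zero_ne := h0
      apply_neg_one := uVec_of_not_mem (by omega)
      apply_last := by rw [zero_smul]; exact uVec_of_not_mem (by omega)
      pos := by omega
      le := le_rfl
      even_or_le := Or.inl hl
      span_eq_top := (hc.linearIndependent (one_mul 1) h0 le_rfl
        (Or.inl hl)).span_eq_top_of_card_eq_finrank' (by simp) }

theorem coe_loopVec {l : ℕ} {a : ZMod 2} {k : ℤ} {γ : Gam} (h : γ = (a, a + (k : ZMod 2))) :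
    (loopVec l a k : Gam →₀ VSp l) = Finsupp.single γ (vVec l k) := by
  rw [h]; rfl

theorem loopVec_mem (l : ℕ) (a : ZMod 2) (k : ℤ) :
    loopVec l a k ∈ (loopGrading hTwo (gradingE l)).sector (a, a + (k : ZMod 2)) :=
  fun _ hδ => Finsupp.single_eq_of_ne hδ

theorem coe_loopSigmaRep_loopVec (l : ℕ) {α : Gam} {x : Slc2} (hx : x ∈ slc2Grading.sector α)
    (a : ZMod 2) (k : ℤ) :
    (loopSigmaRep l x (loopVec l a k) : Gam →₀ VSp l) = ((-1 : ℂ) ^ (α.2 * a).val) •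
      Finsupp.single (α + (a, a + (k : ZMod 2))) (slRep l x (vVec l k)) := by
  rw [loopSigmaRep, recolour_apply_of_mem _ _ _ _ hx (loopVec_mem l a k),
    ← tensorAction_single_of_mem slc2Grading (slRep l) hx]
  rfl

/-- The row a is the first component of the degree. It is changed by a₁ and a₃, of degrees 10 and
11, and kept by a₂, of degree 01. -/
theorem isDoubleChain_loopVec (l : ℕ) : IsDoubleChain (loopSigmaRep l) l (loopVec l) := by
  constructor <;> intro a j <;> ext1
  · have e : ∀ k : ℤ, k = j - 1 ∨ k = j + 1 →
        ((1, 0) : Gam) + (a, a + (j : ZMod 2)) = (a + 1, a + 1 + (k : ZMod 2)) := by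
      rintro k (rfl | rfl) <;> push_cast <;> generalize (j : ZMod 2) = y <;> revert a y <;> decide
    rw [coe_loopSigmaRep_loopVec l a₁_mem_sector]
    simp only [Submodule.coe_smul, Submodule.coe_sub]
    rw [coe_loopVec (e _ (Or.inl rfl)), coe_loopVec (e _ (Or.inr rfl)), slRep_a₁]
    simp only [LinearMap.smul_apply, LinearMap.sub_apply, eOp_vVec, fOp_vVec, zero_mul,
      ZMod.val_zero, pow_zero, one_smul, Finsupp.smul_single, ← Finsupp.single_sub]
  · have e : ∀ k : ℤ, k = j - 1 ∨ k = j + 1 →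
        ((0, 1) : Gam) + (a, a + (j : ZMod 2)) = (a, a + (k : ZMod 2)) := by
      rintro k (rfl | rfl) <;> push_cast <;> generalize (j : ZMod 2) = y <;> revert a y <;> decide
    rw [coe_loopSigmaRep_loopVec l a₂_mem_sector]
    simp only [Submodule.coe_smul, Submodule.coe_add]
    rw [coe_loopVec (e _ (Or.inl rfl)), coe_loopVec (e _ (Or.inr rfl)), slRep_a₂]
    simp only [LinearMap.smul_apply, LinearMap.add_apply, eOp_vVec, fOp_vVec, one_mul,
      Finsupp.smul_single, ← Finsupp.single_add, smul_smul]
    congr 2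
    ring
  · have e : ((1, 1) : Gam) + (a, a + (j : ZMod 2)) = (a + 1, a + 1 + (j : ZMod 2)) := by
      generalize (j : ZMod 2) = y
      revert a y; decide
    rw [coe_loopSigmaRep_loopVec l a₃_mem_sector]
    simp only [Submodule.coe_smul]
    rw [coe_loopVec e, slRep_a₃]
    simp only [LinearMap.smul_apply, hOp_vVec, one_mul, Finsupp.smul_single, smul_smul]
    congr 2
    ring

/-- As l is odd, (-1)^(l-j) = -(-1)^j, which exhibits the vector as a chain plus ξ times its
reversal. -/
theorem uLoopVec_eq {l : ℕ} (hl : Odd l) (ζ ξ : ℤˣ) (j : ℤ) :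
    uLoopVec l ζ ξ j =
      (loopVec l 0 j + (((ζ : ℤ) : ℂ) * Complex.I * (-1) ^ j) • loopVec l 1 j) +
      ((ξ : ℤ) : ℂ) • (loopVec l 0 (l - j) +
        (((ζ : ℤ) : ℂ) * Complex.I * (-1) ^ ((l : ℤ) - j)) • loopVec l 1 (l - j)) := by
  rw [neg_one_zpow_natCast_sub, hl.neg_one_pow, uLoopVec]
  module

theorem isChain_uLoopVec {l : ℕ} (hl : Odd l) (ζ ξ : ℤˣ) :
    IsChain (loopSigmaRep l) l ((ζ : ℤ) : ℂ) (uLoopVec l ζ ξ) := by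
  have h := (isDoubleChain_loopVec l).isChain (intUnits_cast_mul_self ζ)
  have hr := h.reverse
  rw [hl.neg_one_pow, neg_neg, one_mul] at hr
  convert! h.add_smul hr ((ξ : ℤ) : ℂ) using 2 with j
  exact uLoopVec_eq hl ζ ξ j

/-- Exchanging the two summands is multiplication by ξ because ξ² = 1. At the middle this reads
u_{m+1} = ξ u_m, the source of the boundary formulas. -/
theorem uLoopVec_sub {l : ℕ} (hl : Odd l) (ζ ξ : ℤˣ) (j : ℤ) :
    uLoopVec l ζ ξ (l - j) = ((ξ : ℤ) : ℂ) • uLoopVec l ζ ξ j := by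
  have key : ∀ x y : LoopSp l, y + ((ξ : ℤ) : ℂ) • x =
      ((ξ : ℤ) : ℂ) • (x + ((ξ : ℤ) : ℂ) • y) := fun x y => by
    rw [smul_add, smul_smul, intUnits_cast_mul_self, one_smul, add_comm]
  rw [uLoopVec_eq hl, uLoopVec_eq hl, sub_sub_cancel]
  exact key _ _

theorem loopVec_of_not_mem {l : ℕ} (a : ZMod 2) {k : ℤ} (h : ¬ (0 ≤ k ∧ k ≤ l)) :
    loopVec l a k = 0 := by
  ext1
  rw [coe_loopVec rfl, vVec_of_not_mem h, Finsupp.single_zero]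
  rfl

theorem uLoopVec_of_not_mem {l : ℕ} (ζ ξ : ℤˣ) {k : ℤ} (h : ¬ (0 ≤ k ∧ k ≤ l)) :
    uLoopVec l ζ ξ k = 0 := by
  have h' : ¬ (0 ≤ (l : ℤ) - k ∧ (l : ℤ) - k ≤ l) := by omega
  simp [uLoopVec, loopVec_of_not_mem _ h, loopVec_of_not_mem _ h']

theorem uLoopVec_mem {l : ℕ} (hl : Odd l) (ζ ξ : ℤˣ) (k : ℤ) :
    uLoopVec l ζ ξ k ∈ uSpace l ζ ξ := by
  have hlt : ∀ j : ℕ, j < (l + 1) / 2 → uLoopVec l ζ ξ j ∈ uSpace l ζ ξ := fun j hj =>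
    Submodule.subset_span ⟨⟨j, hj⟩, rfl⟩
  by_cases hk : 0 ≤ k ∧ k ≤ l
  · obtain ⟨n, rfl⟩ := Int.eq_ofNat_of_zero_le hk.1
    by_cases hn : n < (l + 1) / 2
    · exact hlt n hn
    · have e : (n : ℤ) = l - ((l - n : ℕ) : ℤ) := by omega
      rw [e, uLoopVec_sub hl]
      exact Submodule.smul_mem _ _ (hlt _ (by obtain ⟨r, rfl⟩ := hl; omega))
  · rw [uLoopVec_of_not_mem _ _ hk]
    exact Submodule.zero_mem _

theorem isStable_uSpace {l : ℕ} (hl : Odd l) (ζ ξ : ℤˣ) :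
    IsStable (loopSigmaRep l) (uSpace l ζ ξ) :=
  (isChain_uLoopVec hl ζ ξ).isStable_of_mem rfl fun j _ _ => uLoopVec_mem hl ζ ξ j

theorem uLoopVec_zero_ne_zero {l : ℕ} (hl : Odd l) (ζ ξ : ℤˣ) : uLoopVec l ζ ξ 0 ≠ 0 := by
  intro h
  -- Among the four summands only v_{0,0} has degree 00: row 1 has first component 1, and v_{0,l}
  -- has degree 01 because l is odd.
  have h1 := congrFun (DFunLike.congr_fun (congrArg Subtype.val h) ((0, 0) : Gam)) 0
  have hl0 : (l : ZMod 2) ≠ 0 := by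
    rwa [Ne, ZMod.natCast_eq_zero_iff_even, Nat.not_even_iff_odd]
  simp [uLoopVec, loopVec, vVec, hl0] at h1

theorem isChainBasis_uLoopVec {l : ℕ} (hl : Odd l) (ζ ξ : ℤˣ)
    (hU : IsStable (loopSigmaRep l) (uSpace l ζ ξ)) :
    IsChainBasis (uRep l ζ ξ hU) l ((ζ : ℤ) : ℂ) ((l + 1) / 2) ((ξ : ℤ) : ℂ)
      (fun j => (⟨uLoopVec l ζ ξ j, uLoopVec_mem hl ζ ξ j⟩ : uSpace l ζ ξ)) where
  map_a₁ j := Subtype.ext ((isChain_uLoopVec hl ζ ξ).map_a₁ j)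
  map_a₂ j := Subtype.ext ((isChain_uLoopVec hl ζ ξ).map_a₂ j)
  map_a₃ j := Subtype.ext ((isChain_uLoopVec hl ζ ξ).map_a₃ j)
  sq_eq_one := intUnits_cast_mul_self ζ
  apply_zero_ne h := uLoopVec_zero_ne_zero hl ζ ξ (congrArg Subtype.val h)
  apply_neg_one := Subtype.ext (uLoopVec_of_not_mem ζ ξ (by omega))
  apply_last := by
    -- For l odd, n = (l + 1)/2 and n - 1 are mirror images under j ↦ l - j, so κ = ξ.
    have e : (((l + 1) / 2 : ℕ) : ℤ) = l - ((((l + 1) / 2 : ℕ) : ℤ) - 1) := by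
      obtain ⟨r, rfl⟩ := hl; omega
    refine Subtype.ext ?_
    change uLoopVec l ζ ξ _ = _ • uLoopVec l ζ ξ _
    conv_lhs => rw [e]
    exact uLoopVec_sub hl ζ ξ _
  pos := by have := hl.pos; omega
  le := by omega
  even_or_le := Or.inr (by omega)
  span_eq_top := by
    refine Submodule.map_injective_of_injective (uSpace l ζ ξ).subtype_injective ?_
    rw [Submodule.map_span, ← Set.range_comp, Submodule.map_top, Submodule.range_subtype]
    rfl

end Models

/-! ### Finding a chain in an arbitrary module -/

section Classification

variable {V : Type*} [AddCommGroup V] [Module ℂ V] {ρ : Slc2 →ₗ[ℂ] Module.End ℂ V}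

/-- The operator `a₂ + s a₁`; for `s = ±1` it sends the `ν`-eigenspace of `a₃` into the
`(s - ν)`-eigenspace. -/
def shiftOp (ρ : Slc2 →ₗ[ℂ] Module.End ℂ V) (s : ℂ) : Module.End ℂ V := ρ a₂ + s • ρ a₁

/-- Moving a₃ past a₂ and a₁ produces a₁ + s a₂ minus ν(a₂ + s a₁), and a₁ + s a₂ = s(a₂ + s a₁)
when s² = 1. -/
theorem a₃_shiftOp (h : IsUngradedRep slc2 ρ) {s ν : ℂ} (hs : s * s = 1) {w : V}
    (hw : ρ a₃ w = ν • w) : ρ a₃ (shiftOp ρ s w) = (s - ν) • shiftOp ρ s w := by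
  obtain ⟨-, h23, h31⟩ := (isUngradedRep_slc2_iff ρ).1 h
  have e23 := LinearMap.congr_fun h23 w
  have e31 := LinearMap.congr_fun h31 w
  simp only [LinearMap.add_apply, Module.End.mul_apply, hw, map_smul] at e23 e31
  simp only [shiftOp, LinearMap.add_apply, LinearMap.smul_apply, map_add, map_smul]
  rw [eq_sub_of_add_eq' e23, eq_sub_of_add_eq e31]
  match_scalars
  · linear_combination -hs
  · ring

/-- The two squares differ only in the cross terms s(a₁a₂ + a₂a₁) = s a₃. This is the counterpart of
[e, f] = h. -/
theorem shiftOp_neg_sq (h : IsUngradedRep slc2 ρ) (s : ℂ) (w : V) :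
    shiftOp ρ (-s) (shiftOp ρ (-s) w) = shiftOp ρ s (shiftOp ρ s w) - (2 * s) • ρ a₃ w := by
  obtain ⟨h12, -, -⟩ := (isUngradedRep_slc2_iff ρ).1 h
  rw [← h12]
  simp only [shiftOp, LinearMap.add_apply, LinearMap.smul_apply, map_add, map_smul,
    Module.End.mul_apply]
  module

/-- If neither operator killed an eigenvector, applying s = 1 and then s = -1 would send ν to 1 - ν
and then to ν - 2, giving infinitely many eigenvalues. -/
theorem exists_shiftOp_eq_zero [FiniteDimensional ℂ V] [Nontrivial V]
    (h : IsUngradedRep slc2 ρ) :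
    ∃ (ζ : ℤˣ) (ν : ℂ) (w : V), w ≠ 0 ∧ ρ a₃ w = ν • w ∧ shiftOp ρ ((ζ : ℤ) : ℂ) w = 0 := by
  by_contra! hne
  obtain ⟨μ, hμ⟩ := Module.End.exists_eigenvalue (ρ a₃)
  have key : ∀ k : ℕ, ∃ w : V, w ≠ 0 ∧ ρ a₃ w = (μ - 2 * k) • w := by
    intro k
    induction k with
    | zero =>
      obtain ⟨v, hv⟩ := hμ.exists_hasEigenvector
      exact ⟨v, hv.2, by simpa using hv.apply_eq_smul⟩
    | succ k ih =>
      obtain ⟨w, hw0, hw⟩ := ih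
      have h1 := a₃_shiftOp h (s := ((1 : ℤˣ) : ℤ)) (by simp) hw
      have h2 := a₃_shiftOp h (s := ((-1 : ℤˣ) : ℤ)) (by simp) h1
      refine ⟨_, hne (-1) _ _ (hne 1 _ _ hw0 hw) h1, h2.trans ?_⟩
      congr 1
      push_cast
      ring
  refine Set.infinite_of_injective_forall_mem (f := fun k : ℕ => μ - 2 * (k : ℂ)) ?_ ?_
    (Module.End.finite_hasEigenvalue (ρ a₃))
  · intro j k hjk
    have : (j : ℂ) = k := by simpa using hjk
    exact_mod_cast this
  · intro k
    obtain ⟨w, hw0, hw⟩ := key k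
    exact Module.End.hasEigenvalue_of_hasEigenvector
      ⟨Module.End.mem_eigenspace_iff.2 hw, hw0⟩

/-- The vectors obtained from `w` by applying `-(a₂ - (-1)^j ζ a₁) / (j + 1)` successively. -/
def raiseSeq (ρ : Slc2 →ₗ[ℂ] Module.End ℂ V) (ζ : ℂ) (w : V) : ℕ → V
  | 0 => w
  | j + 1 => (-(1 / ((j : ℂ) + 1))) • shiftOp ρ (-(ζ * (-1) ^ j)) (raiseSeq ρ ζ w j)

section RaiseSeq

variable {ζ c : ℂ} {w : V}

theorem sign_mul_self (hζ : ζ * ζ = 1) (j : ℕ) :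
    (ζ * (-1 : ℂ) ^ j) * (ζ * (-1) ^ j) = 1 := by
  have : (-1 : ℂ) ^ j * (-1) ^ j = 1 := by rw [← mul_pow]; simp
  linear_combination (-1 : ℂ) ^ j * (-1) ^ j * hζ + this

theorem a₃_raiseSeq (h : IsUngradedRep slc2 ρ) (hζ : ζ * ζ = 1)
    (hw : ρ a₃ w = (-(ζ / 2) * c) • w) (j : ℕ) :
    ρ a₃ (raiseSeq ρ ζ w j) = (-(ζ / 2) * (-1) ^ j * (c - 2 * j)) • raiseSeq ρ ζ w j := by
  induction j with
  | zero => simpa [raiseSeq] using hw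
  | succ j ih =>
    have h1 := a₃_shiftOp h (s := -(ζ * (-1) ^ j))
      (by rw [neg_mul_neg]; exact sign_mul_self hζ j) ih
    rw [raiseSeq, map_smul, h1, smul_comm]
    congr 1
    push_cast
    ring

theorem shiftOp_raiseSeq (j : ℕ) : shiftOp ρ (-(ζ * (-1) ^ j)) (raiseSeq ρ ζ w j) =
    -((j : ℂ) + 1) • raiseSeq ρ ζ w (j + 1) := by
  rw [raiseSeq, smul_smul]
  have : (j : ℂ) + 1 ≠ 0 := by exact_mod_cast Nat.succ_ne_zero j
  rw [show -((j : ℂ) + 1) * -(1 / (j + 1)) = 1 by field_simp, one_smul]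

/-- Induction: the squares of the raising operators at j + 1 and at j differ by a multiple of a₃,
and the raising operator at j commutes with its own square, so the known value at j carries over to
the next vector. -/
theorem shiftOp_sq_raiseSeq (h : IsUngradedRep slc2 ρ) (hζ : ζ * ζ = 1)
    (hw : ρ a₃ w = (-(ζ / 2) * c) • w) (hw0 : shiftOp ρ ζ w = 0) (j : ℕ) :
    shiftOp ρ (-(ζ * (-1) ^ j)) (shiftOp ρ (-(ζ * (-1) ^ j)) (raiseSeq ρ ζ w j)) =
      ((c - j) * (j + 1)) • raiseSeq ρ ζ w j := by
  induction j with
  | zero =>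
    rw [shiftOp_neg_sq h, a₃_raiseSeq h hζ hw]
    simp only [raiseSeq, pow_zero, mul_one, hw0, map_zero, zero_sub, smul_smul, ← neg_smul]
    congr 1
    push_cast
    linear_combination c * hζ
  | succ j ih =>
    have e : ζ * (-1 : ℂ) ^ (j + 1) = -(ζ * (-1) ^ j) := by ring
    have hs := sign_mul_self hζ j
    rw [shiftOp_neg_sq h, a₃_raiseSeq h hζ hw, e, raiseSeq, map_smul, map_smul, ih, map_smul]
    match_scalars
    linear_combination (-(1 / ((j : ℂ) + 1)) * (c - 2 * (j + 1))) * hs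

/-- Since the sign alternates, the operator lowering u_{j+1} is the very one that raised u_j; its
square on u_j is already known. -/
theorem shiftOp_raiseSeq_succ (h : IsUngradedRep slc2 ρ) (hζ : ζ * ζ = 1)
    (hw : ρ a₃ w = (-(ζ / 2) * c) • w) (hw0 : shiftOp ρ ζ w = 0) (j : ℕ) :
    shiftOp ρ (ζ * (-1) ^ (j + 1)) (raiseSeq ρ ζ w (j + 1)) = -(c - j) • raiseSeq ρ ζ w j := by
  have e : ζ * (-1 : ℂ) ^ (j + 1) = -(ζ * (-1) ^ j) := by ring
  have : (j : ℂ) + 1 ≠ 0 := by exact_mod_cast Nat.succ_ne_zero j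
  rw [e, raiseSeq, map_smul, shiftOp_sq_raiseSeq h hζ hw hw0, smul_smul]
  congr 1
  field_simp

theorem exists_raiseSeq_eq_zero [FiniteDimensional ℂ V] (h : IsUngradedRep slc2 ρ)
    (hζ : ζ * ζ = 1) (hw : ρ a₃ w = (-(ζ / 2) * c) • w) : ∃ j, raiseSeq ρ ζ w j = 0 := by
  by_contra! hne
  -- Only even indices are used: there (-1)^j = 1, and the eigenvalues are visibly distinct.
  refine Set.infinite_of_injective_forall_mem
    (f := fun k : ℕ => -(ζ / 2) * (c - 2 * ((2 * k : ℕ) : ℂ))) ?_ ?_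
    (Module.End.finite_hasEigenvalue (ρ a₃))
  · intro j k hjk
    have h0 : -(ζ / 2) ≠ 0 := by
      rw [neg_ne_zero]
      rintro h0
      have : ζ = 0 := by simpa using h0
      simp [this] at hζ
    have h1 := mul_left_cancel₀ h0 hjk
    have h2 : (j : ℂ) = k := by push_cast at h1; linear_combination (-1 / 4) * h1
    exact_mod_cast h2
  · intro k
    refine Module.End.hasEigenvalue_of_hasEigenvector
      ⟨Module.End.mem_eigenspace_iff.2 ?_, hne (2 * k)⟩
    rw [a₃_raiseSeq h hζ hw]
    simp

end RaiseSeq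

theorem IsChain.of_lower_raise {l : ℕ} {ζ : ℂ} {u : ℤ → V} (hζ : ζ * ζ = 1)
    (hlower : ∀ j : ℤ, shiftOp ρ (ζ * (-1) ^ j) (u j) = -((l : ℂ) - j + 1) • u (j - 1))
    (hraise : ∀ j : ℤ, shiftOp ρ (-(ζ * (-1) ^ j)) (u j) = -((j : ℂ) + 1) • u (j + 1))
    (heig : ∀ j : ℤ, ρ a₃ (u j) = (-(ζ / 2) * (-1) ^ j * ((l : ℂ) - 2 * j)) • u j) :
    IsChain ρ l ζ u where
  map_a₁ j := by
    have h1 := hlower j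
    have h2 := hraise j
    have e : (ζ * (-1) ^ j) * (ζ * (-1) ^ j) = 1 := by
      linear_combination (-1 : ℂ) ^ j * (-1) ^ j * hζ + neg_one_zpow_mul_self j
    simp only [shiftOp, LinearMap.add_apply, LinearMap.smul_apply] at h1 h2
    have h3 : ρ a₁ (u j) = ((ζ * (-1) ^ j) / 2) • ((ρ a₂ (u j) + (ζ * (-1) ^ j) • ρ a₁ (u j)) -
        (ρ a₂ (u j) + (-(ζ * (-1) ^ j)) • ρ a₁ (u j))) := by
      match_scalars
      · linear_combination -e
      · ring
    rw [h3, h1, h2]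
    module
  map_a₂ j := by
    have h1 := hlower j
    have h2 := hraise j
    simp only [shiftOp, LinearMap.add_apply, LinearMap.smul_apply] at h1 h2
    have h3 : ρ a₂ (u j) = (1 / 2 : ℂ) • ((ρ a₂ (u j) + (ζ * (-1) ^ j) • ρ a₁ (u j)) +
        (ρ a₂ (u j) + (-(ζ * (-1) ^ j)) • ρ a₁ (u j))) := by module
    rw [h3, h1, h2]
    module
  map_a₃ := heig

/-- The extension of a sequence by zero to all integers. -/
def extendZero {V : Type*} [Zero V] (v : ℕ → V) : ℤ → V
  | Int.ofNat n => v n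
  | Int.negSucc _ => 0

theorem extendZero_natCast {V : Type*} [Zero V] (v : ℕ → V) (n : ℕ) :
    extendZero v (n : ℤ) = v n := rfl

theorem extendZero_negSucc {V : Type*} [Zero V] (v : ℕ → V) (n : ℕ) :
    extendZero v (Int.negSucc n) = 0 := rfl

/-- Raise an eigenvector killed by the lowering operator until the first zero, at index l + 1.
Lowering that zero vector forces the weight to equal l. -/
theorem exists_isChain [FiniteDimensional ℂ V] [Nontrivial V] (h : IsUngradedRep slc2 ρ) :
    ∃ (l : ℕ) (ζ : ℤˣ) (u : ℤ → V), IsChain ρ l ((ζ : ℤ) : ℂ) u ∧ u 0 ≠ 0 ∧ u (-1) = 0 ∧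
      u ((l : ℤ) + 1) = 0 := by
  classical
  obtain ⟨ζ, ν, w, hw0, hwν, hws⟩ := exists_shiftOp_eq_zero h
  have hζ : ((ζ : ℤ) : ℂ) * ((ζ : ℤ) : ℂ) = 1 :=
    intUnits_cast_mul_self ζ
  set z : ℂ := ((ζ : ℤ) : ℂ)
  -- Writes ν as -(z/2)c with c = -2zν, using z² = 1; c is the prospective weight.
  have hw : ρ a₃ w = (-(z / 2) * (-2 * z * ν)) • w := by
    rw [hwν]; congr 1; linear_combination -ν * hζ
  generalize -2 * z * ν = c at hw
  have hex := exists_raiseSeq_eq_zero h hζ hw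
  obtain ⟨l, hl⟩ := Nat.exists_eq_succ_of_ne_zero (n := Nat.find hex) fun h0 =>
    hw0 (by simpa [h0, raiseSeq] using Nat.find_spec hex)
  have hlast : raiseSeq ρ z w (l + 1) = 0 := by
    have := Nat.find_spec hex
    rwa [hl] at this
  have hl0 : raiseSeq ρ z w l ≠ 0 := Nat.find_min hex (by omega)
  obtain rfl : c = l := by
    have h1 := shiftOp_raiseSeq_succ h hζ hw hws l
    rw [hlast, map_zero, eq_comm, smul_eq_zero, neg_eq_zero, sub_eq_zero] at h1
    exact h1.resolve_right hl0
  refine ⟨l, ζ, extendZero (raiseSeq ρ z w), IsChain.of_lower_raise hζ ?_ ?_ ?_, hw0, rfl, hlast⟩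
  · rintro (n | n)
    · cases n with
      | zero =>
        have e : extendZero (raiseSeq ρ z w) (Int.ofNat 0 - 1) = 0 := rfl
        rw [e, smul_zero]
        simpa [extendZero, raiseSeq] using hws
      | succ n =>
        have e : Int.ofNat (n + 1) - 1 = (n : ℤ) := by simp
        rw [e, Int.ofNat_eq_natCast, extendZero_natCast, extendZero_natCast, zpow_natCast,
          shiftOp_raiseSeq_succ h hζ hw hws n]
        congr 1
        push_cast
        ring
    · have e : Int.negSucc n - 1 = Int.negSucc (n + 1) := rfl
      rw [e, extendZero_negSucc, extendZero_negSucc, map_zero, smul_zero]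
  · rintro (n | n)
    · have e : Int.ofNat n + 1 = ((n + 1 : ℕ) : ℤ) := rfl
      rw [e, Int.ofNat_eq_natCast, extendZero_natCast, extendZero_natCast, zpow_natCast,
        shiftOp_raiseSeq, Int.cast_natCast]
    · cases n with
      | zero =>
        -- At index -1 the next vector u_0 is nonzero, but its coefficient (-1) + 1 vanishes.
        rw [extendZero_negSucc, map_zero]
        simp
      | succ n =>
        have e : Int.negSucc (n + 1) + 1 = Int.negSucc n := rfl
        rw [e, extendZero_negSucc, extendZero_negSucc, map_zero, smul_zero]
  · rintro (n | n)
    · rw [Int.ofNat_eq_natCast, extendZero_natCast, zpow_natCast, a₃_raiseSeq h hζ hw,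
        Int.cast_natCast]
    · rw [extendZero_negSucc, map_zero, smul_zero]

theorem IsIrreducibleRep.eq_top_of_mem (hirr : IsIrreducibleRep ρ) {U : Submodule ℂ V}
    (hU : IsStable ρ U) {v : V} (hv : v ∈ U) (hv0 : v ≠ 0) : U = ⊤ :=
  (hirr.2 U hU).resolve_left fun h => hv0 ((Submodule.mem_bot ℂ).1 (h ▸ hv))

/-- The span of the first n vectors is stable, because u_{-1} = 0 and u_n falls back on u_{n-1};
containing u_0 ≠ 0, it is everything. -/
theorem IsIrreducibleRep.isChainBasis (hirr : IsIrreducibleRep ρ) {l n : ℕ} {ζ κ : ℂ} {u : ℤ → V}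
    (hc : IsChain ρ l ζ u) (hζ : ζ * ζ = 1) (h0 : u 0 ≠ 0) (h1 : u (-1) = 0)
    (hlast : u n = κ • u ((n : ℤ) - 1)) (hpos : 0 < n) (hle : n ≤ l + 1)
    (hn : Even l ∨ 2 * n ≤ l + 1) : IsChainBasis ρ l ζ n κ u := by
  refine { hc with
    sq_eq_one := hζ
    apply_zero_ne := h0
    apply_neg_one := h1
    apply_last := hlast
    pos := hpos
    le := hle
    even_or_le := hn
    span_eq_top := ?_ }
  set U := Submodule.span ℂ (Set.range fun j : Fin n => u ((j : ℕ) : ℤ)) with hU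
  have hlt : ∀ j : ℕ, j < n → u j ∈ U := fun j hj => Submodule.subset_span ⟨⟨j, hj⟩, rfl⟩
  refine hirr.eq_top_of_mem (hc.isStable_of_mem hU fun j hj hjn => ?_) (hlt 0 hpos) h0
  rcases lt_trichotomy j (-1) with h | rfl | h
  · omega
  · rw [h1]; exact U.zero_mem
  · lift j to ℕ using by omega
    rcases (Nat.lt_or_ge j n) with h2 | h2
    · exact hlt j h2
    · obtain rfl : j = n := by omega
      obtain ⟨m, rfl⟩ := Nat.exists_eq_succ_of_ne_zero hpos.ne'
      have e : (((m + 1 : ℕ) : ℤ) - 1) = (m : ℤ) := by push_cast; ring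
      rw [hlast, Nat.succ_eq_add_one, e]
      exact U.smul_mem _ (hlt m (by omega))

/-- Every finite-dimensional irreducible module has a basis consisting of a chain. -/
theorem IsIrreducibleRep.exists_isChainBasis [FiniteDimensional ℂ V] (h : IsUngradedRep slc2 ρ)
    (hirr : IsIrreducibleRep ρ) :
    (∃ (l : ℕ) (u : ℤ → V), Even l ∧ IsChainBasis ρ l 1 (l + 1) 0 u) ∨
    (∃ (l : ℕ) (ζ ξ : ℤˣ) (u : ℤ → V), Odd l ∧
      IsChainBasis ρ l ((ζ : ℤ) : ℂ) ((l + 1) / 2) ((ξ : ℤ) : ℂ) u) := by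
  have : Nontrivial V := hirr.1
  obtain ⟨l, ζ, u, hc, h0, h1, hlast⟩ := exists_isChain h
  have hζ : ((ζ : ℤ) : ℂ) * ((ζ : ℤ) : ℂ) = 1 :=
    intUnits_cast_mul_self ζ
  have hr := hc.reverse
  have e1 : (l : ℤ) - (-1) = l + 1 := by ring
  rcases Nat.even_or_odd l with hl | hl
  · refine Or.inl ⟨l, ?_⟩
    rcases Int.units_eq_one_or ζ with rfl | rfl
    · refine ⟨u, hl, hirr.isChainBasis (by simpa using hc) (one_mul 1) h0 h1 ?_ (by omega) le_rfl
        (Or.inl hl)⟩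
      rw [zero_smul]
      exact_mod_cast hlast
    -- For l even, reversal turns ζ = -1 into ζ = 1; its new first vector is u_l, which is nonzero
    -- by `ne_zero`.
    · refine ⟨fun j => u (l - j), hl, hirr.isChainBasis
        (by simpa [hl.neg_one_pow] using hr) (one_mul 1) ?_ ?_ ?_ (by omega) le_rfl (Or.inl hl)⟩
      · simpa using hc.ne_zero hζ h0 l le_rfl
      · rw [e1, hlast]
      · rw [zero_smul, ← h1]; congr 1; push_cast; ring
  · rw [hl.neg_one_pow, neg_neg, one_mul] at hr
    -- The vectors u_0 + u_l and u_0 - u_l add up to 2u_0, so they cannot both vanish; the folded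
    -- chain thus has a nonzero start for some ξ.
    obtain ⟨ξ, hξ⟩ : ∃ ξ : ℤˣ, u 0 + ((ξ : ℤ) : ℂ) • u l ≠ 0 := by
      by_contra! hall
      have h2 := hall 1
      have h3 := hall (-1)
      refine h0 ?_
      have : u 0 = (1 / 2 : ℂ) • ((u 0 + (((1 : ℤˣ) : ℤ) : ℂ) • u l) +
          (u 0 + (((-1 : ℤˣ) : ℤ) : ℂ) • u l)) := by
        push_cast
        module
      rw [this, h2, h3, add_zero, smul_zero]
    refine Or.inr ⟨l, ζ, ξ, fun j => u j + ((ξ : ℤ) : ℂ) • u (l - j), hl,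
      hirr.isChainBasis (hc.add_smul hr _) hζ (by simpa using hξ) ?_ ?_
        (by have := hl.pos; omega) (by omega) (Or.inr (by omega))⟩
    · rw [h1, e1, hlast, smul_zero, add_zero]
    · obtain ⟨m, rfl⟩ := hl
      have e2 : (((2 * m + 1 + 1) / 2 : ℕ) : ℤ) = m + 1 := by omega
      have e3 : ((2 * m + 1 : ℕ) : ℤ) - (m + 1) = m := by omega
      have e4 : ((2 * m + 1 : ℕ) : ℤ) - m = m + 1 := by omega
      have hξ2 : ((ξ : ℤ) : ℂ) * ((ξ : ℤ) : ℂ) = 1 :=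
        intUnits_cast_mul_self ξ
      rw [e2, e3, add_sub_cancel_right, e4, smul_add, smul_smul, hξ2, one_smul, add_comm]

end Classification

end ColourSl2

end

/-! ### Assembling the classification -/

namespace ColourSl2

theorem intUnits_cast_injective {ζ ζ' : ℤˣ} (h : ((ζ : ℤ) : ℂ) = ((ζ' : ℤ) : ℂ)) : ζ = ζ' :=
  Units.ext (Int.cast_injective h)

end ColourSl2

open ColourSl2 in
theorem mainTheorem7 :
    ∃ hU : ∀ l : ℕ, Odd l → ∀ ζ ξ : ℤˣ, IsStable (loopSigmaRep l) (uSpace l ζ ξ),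
    -- the modules with `l` even
    (∀ (l : ℕ) (hl : Even l),
      IsUngradedRep slc2 (vRep l hl) ∧ IsIrreducibleRep (vRep l hl) ∧
      Module.finrank ℂ (VSp l) = l + 1 ∧
      (∃ b : Module.Basis (Fin (l + 1)) ℂ (VSp l), ∀ j, b j = uVec l ((j : ℕ) : ℤ)) ∧
      uVec l (-1) = 0 ∧ uVec l ((l : ℤ) + 1) = 0 ∧
      ∀ j : ℕ, j ≤ l →
        vRep l hl a₁ (uVec l j) = ((-1 : ℂ) ^ (j + 1) / 2) •
          (((l : ℂ) - j + 1) • uVec l ((j : ℤ) - 1) - ((j : ℂ) + 1) • uVec l ((j : ℤ) + 1)) ∧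
        vRep l hl a₂ (uVec l j) = (-(1 / 2) : ℂ) •
          (((l : ℂ) - j + 1) • uVec l ((j : ℤ) - 1) + ((j : ℂ) + 1) • uVec l ((j : ℤ) + 1)) ∧
        vRep l hl a₃ (uVec l j) = ((-1 : ℂ) ^ (j + 1) / 2 * ((l : ℂ) - 2 * j)) • uVec l j) ∧
    -- the modules with `l` odd
    (∀ (l : ℕ) (hl : Odd l) (ζ ξ : ℤˣ),
      IsUngradedRep (V := uSpace l ζ ξ) slc2 (uRep l ζ ξ (hU l hl ζ ξ)) ∧
      IsIrreducibleRep (uRep l ζ ξ (hU l hl ζ ξ)) ∧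
      Module.finrank ℂ (uSpace l ζ ξ) = (l + 1) / 2 ∧
      (∃ b : Module.Basis (Fin ((l + 1) / 2)) ℂ (uSpace l ζ ξ),
        ∀ j, (b j : LoopSp l) = uLoopVec l ζ ξ ((j : ℕ) : ℤ)) ∧
      uLoopVec l ζ ξ (-1) = 0 ∧
      (∀ j : ℕ, 2 * j + 1 < l →
        loopSigmaRep l a₁ (uLoopVec l ζ ξ j) = (-(((ζ : ℤ) : ℂ) / 2) * (-1) ^ j) •
          (((l : ℂ) - j + 1) • uLoopVec l ζ ξ ((j : ℤ) - 1)
            - ((j : ℂ) + 1) • uLoopVec l ζ ξ ((j : ℤ) + 1)) ∧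
        loopSigmaRep l a₂ (uLoopVec l ζ ξ j) = (-(1 / 2) : ℂ) •
          (((l : ℂ) - j + 1) • uLoopVec l ζ ξ ((j : ℤ) - 1)
            + ((j : ℂ) + 1) • uLoopVec l ζ ξ ((j : ℤ) + 1)) ∧
        loopSigmaRep l a₃ (uLoopVec l ζ ξ j) =
          (-(((ζ : ℤ) : ℂ) / 2) * (-1) ^ j * ((l : ℂ) - 2 * j)) • uLoopVec l ζ ξ j) ∧
      (∀ m : ℕ, l = 2 * m + 1 →
        loopSigmaRep l a₁ (uLoopVec l ζ ξ m) = (-(((ζ : ℤ) : ℂ) / 2) * (-1) ^ m) •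
          ((((l : ℂ) + 3) / 2) • uLoopVec l ζ ξ ((m : ℤ) - 1)
            - (((ξ : ℤ) : ℂ) * (((l : ℂ) + 1) / 2)) • uLoopVec l ζ ξ m) ∧
        loopSigmaRep l a₂ (uLoopVec l ζ ξ m) = (-(1 / 2) : ℂ) •
          ((((l : ℂ) + 3) / 2) • uLoopVec l ζ ξ ((m : ℤ) - 1)
            + (((ξ : ℤ) : ℂ) * (((l : ℂ) + 1) / 2)) • uLoopVec l ζ ξ m) ∧
        loopSigmaRep l a₃ (uLoopVec l ζ ξ m) =
          (-(((ζ : ℤ) : ℂ) / 2) * (-1) ^ m * ((l : ℂ) - 2 * m)) • uLoopVec l ζ ξ m)) ∧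
    -- there are no other finite-dimensional ungraded irreducible modules
    (∀ (V : Type*) [AddCommGroup V] [Module ℂ V] [FiniteDimensional ℂ V]
      (ρ : Slc2 →ₗ[ℂ] Module.End ℂ V), IsUngradedRep slc2 ρ → IsIrreducibleRep ρ →
      (∃ (l : ℕ) (hl : Even l), Isomorphic ρ (vRep l hl)) ∨
      (∃ (l : ℕ) (hl : Odd l) (ζ ξ : ℤˣ),
        Isomorphic ρ (uRep l ζ ξ (hU l hl ζ ξ)))) ∧
    -- the listed modules are pairwise non-isomorphic
    (∀ (l l' : ℕ) (hl : Even l) (hl' : Even l'),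
      Isomorphic (vRep l hl) (vRep l' hl') → l = l') ∧
    (∀ (l l' : ℕ) (hl : Odd l) (hl' : Odd l') (ζ ξ ζ' ξ' : ℤˣ),
      Isomorphic (uRep l ζ ξ (hU l hl ζ ξ))
        (uRep l' ζ' ξ' (hU l' hl' ζ' ξ')) →
      l = l' ∧ ζ = ζ' ∧ ξ = ξ') ∧
    (∀ (l l' : ℕ) (hl : Even l) (hl' : Odd l') (ζ ξ : ℤˣ),
      ¬ Isomorphic (vRep l hl)
        (uRep l' ζ ξ (hU l' hl' ζ ξ))) := by
  refine ⟨fun l hl ζ ξ => isStable_uSpace hl ζ ξ, ?_, ?_, ?_, ?_, ?_, ?_⟩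
  · intro l hl
    have h := isChainBasis_uVec l hl
    refine ⟨h.isUngradedRep, h.isIrreducibleRep, h.finrank, ⟨h.basis, h.basis_apply⟩,
      h.apply_neg_one, uVec_of_not_mem (by omega), fun j _ => ⟨?_, ?_, ?_⟩⟩
    · rw [h.map_a₁, zpow_natCast, Int.cast_natCast]
      congr 1
      ring
    · rw [h.map_a₂, Int.cast_natCast]
    · rw [h.map_a₃, zpow_natCast, Int.cast_natCast]
      congr 1
      ring
  · intro l hl ζ ξ
    have h := isChainBasis_uLoopVec hl ζ ξ (isStable_uSpace hl ζ ξ)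
    have hc := isChain_uLoopVec hl ζ ξ
    refine ⟨h.isUngradedRep, h.isIrreducibleRep, h.finrank,
      ⟨h.basis, fun j => congrArg Subtype.val (h.basis_apply j)⟩,
      uLoopVec_of_not_mem ζ ξ (by omega), fun j _ => ⟨?_, ?_, ?_⟩, ?_⟩
    · rw [hc.map_a₁, zpow_natCast, Int.cast_natCast]
    · rw [hc.map_a₂, Int.cast_natCast]
    · rw [hc.map_a₃, zpow_natCast, Int.cast_natCast]
    · rintro m rfl
      -- The reflection of m is m + 1, so the general chain formula at m closes up on u_m; its
      -- coefficients there are (l + 3)/2 and (l + 1)/2.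
      have hm : uLoopVec (2 * m + 1) ζ ξ ((m : ℤ) + 1) =
          ((ξ : ℤ) : ℂ) • uLoopVec (2 * m + 1) ζ ξ m := by
        rw [← uLoopVec_sub hl]
        congr 1
        push_cast
        ring
      refine ⟨?_, ?_, ?_⟩
      · rw [hc.map_a₁, zpow_natCast, Int.cast_natCast, hm]
        push_cast
        module
      · rw [hc.map_a₂, Int.cast_natCast, hm]
        push_cast
        module
      · rw [hc.map_a₃, zpow_natCast, Int.cast_natCast]
  · intro V _ _ _ ρ hρ hirr
    rcases hirr.exists_isChainBasis hρ with ⟨l, u, hl, h⟩ | ⟨l, ζ, ξ, u, hl, h⟩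
    · exact Or.inl ⟨l, hl, h.isomorphic (isChainBasis_uVec l hl)⟩
    · exact Or.inr ⟨l, hl, ζ, ξ, h.isomorphic (isChainBasis_uLoopVec hl ζ ξ (isStable_uSpace hl ζ ξ))⟩
  · intro l l' hl hl' hiso
    have := hiso.finrank_eq
    rw [(isChainBasis_uVec l hl).finrank, (isChainBasis_uVec l' hl').finrank] at this
    omega
  · intro l l' hl hl' ζ ξ ζ' ξ' hiso
    -- The dimension gives l, the trace of a₂ gives ξ and the trace of a₃ gives ζ.
    have h1 := Isomorphic.finrank_eq (V := uSpace l ζ ξ) (V' := uSpace l' ζ' ξ') hiso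
    have h2 := Isomorphic.trace_eq (V := uSpace l ζ ξ) (V' := uSpace l' ζ' ξ') hiso a₂
    have h3 := Isomorphic.trace_eq (V := uSpace l ζ ξ) (V' := uSpace l' ζ' ξ') hiso a₃
    have b := isChainBasis_uLoopVec hl ζ ξ (isStable_uSpace hl ζ ξ)
    have b' := isChainBasis_uLoopVec hl' ζ' ξ' (isStable_uSpace hl' ζ' ξ')
    rw [b.finrank, b'.finrank] at h1
    rw [b.trace_a₂, b'.trace_a₂, ← h1] at h2
    rw [b.trace_a₃ (by obtain ⟨r, rfl⟩ := hl; omega),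
      b'.trace_a₃ (by obtain ⟨r, rfl⟩ := hl'; omega), ← h1] at h3
    have hn : (((l + 1) / 2 : ℕ) : ℂ) ≠ 0 := by
      have := hl.pos
      exact Nat.cast_ne_zero.2 (by omega)
    refine ⟨by obtain ⟨r, rfl⟩ := hl; obtain ⟨s, rfl⟩ := hl'; omega,
      intUnits_cast_injective (mul_right_cancel₀ hn ?_),
      intUnits_cast_injective (mul_right_cancel₀ hn ?_)⟩
    · linear_combination -2 * h3
    · linear_combination -2 * h2
  · intro l l' hl hl' ζ ξ hiso
    -- a₂ has trace 0 on the modules with l even, where κ = 0, and nonzero trace on those with l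
    -- odd, where κ = ξ.
    have h2 := Isomorphic.trace_eq (V' := uSpace l' ζ ξ) hiso a₂
    rw [(isChainBasis_uVec l hl).trace_a₂, (isChainBasis_uLoopVec hl' ζ ξ (isStable_uSpace hl' ζ ξ)).trace_a₂] at h2
    have hn : (((l' + 1) / 2 : ℕ) : ℂ) ≠ 0 := by
      have := hl'.pos
      exact Nat.cast_ne_zero.2 (by omega)
    have h3 : ((ξ : ℤ) : ℂ) * (((l' + 1) / 2 : ℕ) : ℂ) = 0 := by linear_combination 2 * h2
    rcases mul_eq_zero.1 h3 with h4 | h4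
    · have := intUnits_cast_mul_self ξ
      simp [h4] at this
    · exact hn h4
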